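/- Let $\mathcal C_n=\{x\in\mathbb R^n: 0\le x_i\le 1 \text{ for all } i\}$ be the standard $n$-cube, $n\ge 1$. Definitions. For a full-dimensional convex polytope $\mathcal P\subset\mathbb R^n$, $\mathrm{vis}(\mathcal P)$ is the set of affine spans of its facets. For a finite arrangement $\mathcal A$ of affine hyperplanes and a point $p$ on none of them, $\mathrm{vo}(\mathcal A,p)$ is the set of hyperplanes consisting of $\mathrm{aff}(\{p\}\cup(H\cap H'))$ for non-parallel $H,H'\in\mathcal A$, and of the hyperplane through $p$ parallel to $H$ and $H'$ for distinct parallel $H,H'\in\mathcal A$. The characteristic polynomial of an arrangement $\mathcal B$ in $\mathbb R^n$ is $\chi_{\mathcal B}(q)=\sum_X\mu(\mathbb R^n,X)\,q^{\dim X}$, where $X$ ranges over the poset of nonempty intersections of members of $\mathcal B$ (including $\mathbb R^n$), ordered by reverse inclusion, and $\mu$ is its Möbius function. A line shelling of $\mathcal P$ through an interior point $p$ is an ordering of the facets obtained from a directed line through $p$ that meets the affine spans of the facets in pairwise distinct points and is parallel to none of them: the facets are listed in the order in which their affine spans are crossed when one starts at $p$, moves along the line in its direction to infinity, and returns to $p$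 from the opposite side. A line shelling of $\mathcal P$ is a line shelling through some interior point. A shelling of a $d$-polytope, $d\ge1$, is an ordering $F_1,\dots,F_s$ of its facets that is arbitrary if $d=1$ and, if $d\ge 2$, is such that for every $j$ the facet $F_j$ has a shelling $G_1,\dots,G_t$ with $F_j\cap(F_1\cup\dots\cup F_{j-1})=G_1\cup\dots\cup G_r$ for some $0\le r\le t$, this intersection being nonempty when $j>1$. Theorem. (a) For every $n\ge1$ let $p=(\frac12,\dots,\frac12)$ be the center of $\mathcal C_n$. Then $\mathrm{vo}(\mathrm{vis}(\mathcal C_n),p)$ is the translate by $p$ of the type $B_n$ Coxeter arrangement $\{x_i=0\}$ $(1\le i\le n)$, $\{x_i=x_j\}$, $\{x_i=-x_j\}$ $(1\le i<j\le n)$; its characteristic polynomial is $$\chi_{\mathrm{vo}(\mathrm{vis}(\mathcal C_n),p)}(q)=(q-1)(q-3)\cdots(q-(2n-1));$$ and the number of line shellings of $\mathcal C_n$ through $p$ is $2^n\,n!$. (b) For every $n\ge 1$ the total number of line shellings of $\mathcal C_n$ is $2^n\,(n!)^2$. (c) Let $f(n)$ be the total number of shellings of $\mathcal C_n$. Then,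 as formal power series, $$\sum_{n\ge1}f(n)\frac{x^n}{n!}=1-\frac1{\sum_{n\ge0}(2n)!\,\frac{x^n}{n!}}.$$ (d) For every $n\ge1$, every shelling of $\mathcal C_n$ can be realized as a line shelling of a polytope combinatorially equivalent to $\mathcal C_n$: for every shelling $F_1,\dots,F_{2n}$ of $\mathcal C_n$ there are a polytope $\mathcal Q\subset\mathbb R^n$ and an isomorphism $e$ from the face lattice of $\mathcal C_n$ to that of $\mathcal Q$ such that $e(F_1),\dots,e(F_{2n})$ is a line shelling of $\mathcal Q$. -/

import Mathlib

open Polynomial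
open scoped Nat

noncomputable section

section Polytopes

variable {E : Type*} [NormedAddCommGroup E] [NormedSpace ℝ E]

/-- A convex polytope: the convex hull of finitely many points. -/
def IsPolytope (P : Set E) : Prop := ∃ s : Finset E, P = convexHull ℝ (s : Set E)

/-- The dimension of (the affine span of) a nonempty set. -/
def affDim (P : Set E) : ℕ := Module.finrank ℝ (vectorSpan ℝ P)

/-- The faces of `P` (including `∅` and `P`), ordered by inclusion. The nonempty ones are the sets
of points of `P` at which some linear functional attains its maximum over `P`. -/
abbrev Face (P : Set E) : Type _ := {F : Set E // IsExposed ℝ P F}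

/-- The facets of `P`: the nonempty faces of dimension one less than `P`. -/
def IsFacet (P F : Set E) : Prop :=
  IsExposed ℝ P F ∧ F.Nonempty ∧ affDim F + 1 = affDim P

/-- `L` lists every facet of `P` exactly once. -/
def IsFacetOrdering (P : Set E) (L : List (Set E)) : Prop :=
  L.Nodup ∧ ∀ F, F ∈ L ↔ IsFacet P F

/-- The union of the first `k` members of a list of sets. -/
def prefixUnion (L : List (Set E)) (k : ℕ) : Set E := {x | ∃ F ∈ L.take k, x ∈ F}

/-- Shellings of the boundary complex of a `d`-dimensional polytope, by recursion on `d`.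
If the boundary complex has dimension at most `0`, every ordering of the facets is a shelling.
Otherwise the ordering `F₀, F₁, …` is a shelling if the boundary of every facet `Fⱼ` has a shelling
`G₀, G₁, …` such that the intersection of `Fⱼ` with the union of the earlier facets is the union of
an initial segment `G₀, …, Gᵣ₋₁`, and this intersection is nonempty for `0 < j`. -/
def IsShellingOfDim : ℕ → Set E → List (Set E) → Prop
  | 0, P, L => IsFacetOrdering P L
  | 1, P, L => IsFacetOrdering P L
  | d + 2, P, L => IsFacetOrdering P L ∧
      ∀ (j : ℕ) (hj : j < L.length),
        (0 < j → (L[j] ∩ prefixUnion L j).Nonempty) ∧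
        ∃ G : List (Set E), IsShellingOfDim (d + 1) L[j] G ∧
          ∃ r ≤ G.length, L[j] ∩ prefixUnion L j = prefixUnion G r

/-- `L` is a shelling of (the boundary complex of) the polytope `P`. -/
def IsShelling (P : Set E) (L : List (Set E)) : Prop := IsShellingOfDim (affDim P) P L

/-- The order in which the parameters `t ≠ 0` are met when one starts at `t = 0`, moves to `+∞`,
and comes back from `-∞` to `0`. -/
def MetBefore (s t : ℝ) : Prop := (0 < s ∧ t < 0) ∨ (0 < s * t ∧ s < t)

/-- `L` is the line shelling of `P` given by the line `t ↦ p + t • v` through the interior point `p`,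
directed by `v`: the line meets the affine span of each facet `F` in exactly one point
`p + τ F • v`, these points are distinct, and the facets are listed in the order in which their
affine spans are crossed when one leaves `p` in direction `v`, passes through infinity, and
returns to `p` from the opposite side. -/
def IsLineShellingAlong (P : Set E) (p v : E) (L : List (Set E)) : Prop :=
  p ∈ interior P ∧ IsFacetOrdering P L ∧
    ∃ τ : Set E → ℝ,
      (∀ F ∈ L, ∀ t : ℝ, p + t • v ∈ affineSpan ℝ F ↔ t = τ F) ∧
      L.Pairwise (fun F G => MetBefore (τ F) (τ G))

/-- The line shellings of `P` whose shelling line passes through `p`. -/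
def lineShellingsThrough (P : Set E) (p : E) : Set (List (Set E)) :=
  {L | ∃ v : E, IsLineShellingAlong P p v L}

/-- All line shellings of `P`. -/
def lineShellings (P : Set E) : Set (List (Set E)) :=
  {L | ∃ p : E, L ∈ lineShellingsThrough P p}

/-- All shellings of `P`. -/
def shellings (P : Set E) : Set (List (Set E)) := {L | IsShelling P L}

end Polytopes

section Arrangements

variable {E : Type*} [NormedAddCommGroup E] [NormedSpace ℝ E]

/-- The visibility arrangement: the affine spans of the facets of `P`. -/
def visArrangement (P : Set E) : Set (AffineSubspace ℝ E) :=
  {H | ∃ F, IsFacet P F ∧ H = affineSpan ℝ F}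

/-- The valid order arrangement of `A` with respect to `p`: the affine spans of `p` and `H ∩ H'` for
non-parallel `H, H'` in `A`, and the translates through `p` of distinct parallel `H, H'` in `A`. -/
def validOrderArrangement (A : Set (AffineSubspace ℝ E)) (p : E) : Set (AffineSubspace ℝ E) :=
  {K | ∃ H ∈ A, ∃ H' ∈ A, ¬ H.Parallel H' ∧
      K = affineSpan ℝ (insert p ((H : Set E) ∩ (H' : Set E)))} ∪
  {K | ∃ H ∈ A, ∃ H' ∈ A, H ≠ H' ∧ H.Parallel H' ∧ K = AffineSubspace.mk' p H.direction}

/-- The nonempty intersections of members of `A` (the whole space being the empty intersection). -/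
def intersectionSet (A : Set (AffineSubspace ℝ E)) : Set (AffineSubspace ℝ E) :=
  {X | X ≠ ⊥ ∧ ∃ B ⊆ A, X = sInf B}

theorem intersectionSet_finite {A : Set (AffineSubspace ℝ E)} (hA : A.Finite) :
    (intersectionSet A).Finite := by
  refine (hA.finite_subsets.image sInf).subset ?_
  rintro X ⟨-, B, hB, rfl⟩
  exact ⟨B, hB, rfl⟩

/-- The intersection poset of `A`, ordered by reverse inclusion. -/
abbrev IntersectionPoset (A : Set (AffineSubspace ℝ E)) : Type _ := (intersectionSet A)ᵒᵈ

/-- The whole space, as the least element of the intersection poset. -/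
def IntersectionPoset.whole (A : Set (AffineSubspace ℝ E)) : IntersectionPoset A :=
  OrderDual.toDual ⟨⊤, AffineSubspace.bot_ne_top ℝ E E |>.symm, ∅, Set.empty_subset _, by simp⟩

theorem intersectionPoset_finite {A : Set (AffineSubspace ℝ E)} (hA : A.Finite) :
    Finite (IntersectionPoset A) :=
  Finite.of_equiv _ (OrderDual.toDual (α := intersectionSet A))
    (h := (intersectionSet_finite hA).to_subtype)

/-- The polynomial `∑ μ(V, Y) q ^ dim Y`, where `Y` runs over the intersection poset of `A` and `μ` is
the Möbius function of this poset. -/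
def moebiusPoly (A : Set (AffineSubspace ℝ E)) [Fintype (IntersectionPoset A)]
    [LocallyFiniteOrder (IntersectionPoset A)] [DecidableEq (IntersectionPoset A)] : ℤ[X] :=
  ∑ Y : IntersectionPoset A,
    C (IncidenceAlgebra.mu ℤ (IntersectionPoset.whole A) Y) *
      X ^ Module.finrank ℝ (OrderDual.ofDual Y).1.direction

open Classical in
/-- The characteristic polynomial of a finite arrangement (and `0` for an infinite set `A`). -/
def arrangementCharPoly (A : Set (AffineSubspace ℝ E)) : ℤ[X] :=
  if hA : A.Finite then
    letI : Finite (IntersectionPoset A) := intersectionPoset_finite hA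
    letI : Fintype (IntersectionPoset A) := Fintype.ofFinite _
    letI : LocallyFiniteOrder (IntersectionPoset A) := Fintype.toLocallyFiniteOrder
    moebiusPoly A
  else 0

end Arrangements

section Cube

/-- The standard cube `0 ≤ xᵢ ≤ 1` in `ℝⁿ`. -/
def stdCube (n : ℕ) : Set (Fin n → ℝ) := {x | ∀ i, 0 ≤ x i ∧ x i ≤ 1}

/-- The center `(1/2, …, 1/2)` of the standard cube. -/
def cubeCenter (n : ℕ) : Fin n → ℝ := fun _ => 1 / 2

/-- The Coxeter arrangement of type `Bₙ`: the linear hyperplanes `xᵢ = 0`, and `xᵢ = xⱼ` and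
`xᵢ = -xⱼ` for `i < j`. -/
def coxeterB (n : ℕ) : Set (Submodule ℝ (Fin n → ℝ)) :=
  {W | ∃ i, ∀ x, x ∈ W ↔ x i = 0} ∪
  {W | ∃ i j, i < j ∧ ∀ x, x ∈ W ↔ x i = x j} ∪
  {W | ∃ i j, i < j ∧ ∀ x, x ∈ W ↔ x i = -x j}

/-- The number of all shellings of the standard `n`-cube. -/
def numCubeShellings (n : ℕ) : ℕ := (shellings (stdCube n)).ncard

/-- The ordering `L` of facets of `P` corresponds to the ordering `L'` of facets of `Q` under the
isomorphism `e` of face lattices. -/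
def Corresponds {E E' : Type*} [NormedAddCommGroup E] [NormedSpace ℝ E]
    [NormedAddCommGroup E'] [NormedSpace ℝ E'] {P : Set E} {Q : Set E'} (e : Face P ≃o Face Q)
    (L : List (Set E)) (L' : List (Set E')) : Prop :=
  List.Forall₂ (fun F G => ∃ hF : IsExposed ℝ P F, (e ⟨F, hF⟩ : Set E') = G) L L'

end Cube

end

/-!
A facet of the cube is named by a label: a coordinate `i` together with the side, `xᵢ = 0` or
`xᵢ = 1`, on which it lies. A set of facets has a common point exactly when it contains no two
opposite ones, and this determines the face lattice.

*Shellings.* By induction on the dimension, an ordering of the facets is a shelling if and only if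
no proper nonempty initial segment is closed under passing to the opposite facet. Cutting an
arbitrary ordering at its first nonempty initial segment that is closed yields
`(2n)! = ∑ k, (n choose k) * f(k) * (2(n - k))!` for `n ≥ 1`, which is the identity in (c).

*Line shellings of the cube.* Along a generic line from an interior point, exactly one facet of each
opposite pair is crossed before infinity. The crossing times of these `n` facets and of the `n`
others can be ordered independently if the point can be chosen, so there are `2ⁿ (n!)²` line
shellings; from the center, opposite facets are crossed at opposite times, so that the first order
determines the second and `2ⁿ n!` remain.

*Realization.* By polarity, a line shelling of a polytope is an ordering of the vertices of the
polar dual by height. It therefore suffices to find a combinatorial cross-polytope whose vertices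
have prescribed heights, and one is built from iterated bipyramids. A new pair of apices can be
added when the segment of heights between them contains the height of an interior point; a suitable
order of the pairs exists because the union of the open intervals of heights between opposite
vertices is connected, and this is the condition on initial segments found above.

*The arrangement.* For an arrangement whose flats of dimension `d` contain exactly `q ^ d` points of
a finite set `Z`, Möbius inversion shows that its characteristic polynomial at `q` counts the points
of `Z` on no hyperplane. For type `B` take the integer points of `[-m, m]ⁿ`, with `q = 2m + 1`:
those on no hyperplane have nonzero coordinates with distinct absolute values.
-/

section FacetLabels

/-- Names of the facets of a cube with coordinates `ι`: the label `(i, true)` stands for the facet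
`xᵢ = 1` and `(i, false)` for `xᵢ = 0`. -/
abbrev FacetLabel (ι : Type*) := ι × Bool

namespace FacetLabel

variable {ι : Type*}

/-- The label of the opposite facet. -/
def opp (k : FacetLabel ι) : FacetLabel ι := (k.1, !k.2)

@[simp] theorem opp_mk (i : ι) (b : Bool) : opp (i, b) = (i, !b) := rfl

@[simp] theorem opp_fst (k : FacetLabel ι) : (opp k).1 = k.1 := rfl

theorem opp_ne (k : FacetLabel ι) : opp k ≠ k := fun h => Bool.not_ne_self k.2 (congrArg Prod.snd h)

theorem eq_or_eq_opp {k l : FacetLabel ι} (h : k.1 = l.1) : k = l ∨ k = opp l := by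
  rcases Bool.eq_or_eq_not k.2 l.2 with h' | h'
  exacts [Or.inl (Prod.ext h h'), Or.inr (Prod.ext h h')]

/-- A set of facet labels is consistent if it has no opposite pairs, that is, if the facets that it
names have a common point. -/
def Consistent (T : Set (FacetLabel ι)) : Prop := ∀ k ∈ T, opp k ∉ T

theorem Consistent.eq_of_fst_eq {T : Set (FacetLabel ι)} (hT : Consistent T) {k l : FacetLabel ι}
    (hk : k ∈ T) (hl : l ∈ T) (h : k.1 = l.1) : k = l :=
  (eq_or_eq_opp h).resolve_right fun h' => hT l hl (h' ▸ hk)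

theorem consistent_empty : Consistent (∅ : Set (FacetLabel ι)) := fun _ h => h.elim

theorem consistent_singleton (k : FacetLabel ι) : Consistent {k} := by
  rintro _ rfl
  exact opp_ne _

theorem not_consistent_univ [Nonempty ι] : ¬ Consistent (Set.univ : Set (FacetLabel ι)) :=
  fun h => h (Classical.arbitrary ι, true) trivial trivial

theorem Consistent.exists_vertex {T : Set (FacetLabel ι)} (hT : Consistent T) :
    ∃ s : ι → Bool, ∀ k ∈ T, s k.1 = k.2 := by
  classical
  refine ⟨fun i => decide ((i, true) ∈ T), ?_⟩
  rintro ⟨i, b⟩ hk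
  cases b
  · simpa using hT _ hk
  · simpa using hk

section FreeDirs

variable [Fintype ι]

open Classical in
/-- The directions in which no label of `T` points: those of the edges of the face common to the
facets that `T` names. -/
noncomputable def freeDirs (T : Set (FacetLabel ι)) : Finset ι := {i | ∀ b, (i, b) ∉ T}

theorem mem_freeDirs {T : Set (FacetLabel ι)} {i : ι} : i ∈ freeDirs T ↔ ∀ b, (i, b) ∉ T := by
  simp [freeDirs]

theorem notMem_freeDirs {T : Set (FacetLabel ι)} {i : ι} : i ∉ freeDirs T ↔ ∃ b, (i, b) ∈ T := by
  simp only [mem_freeDirs, not_forall, not_not]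

theorem freeDirs_anti {T T' : Set (FacetLabel ι)} (h : T ⊆ T') : freeDirs T' ⊆ freeDirs T :=
  fun _ hi => mem_freeDirs.2 fun b hb => mem_freeDirs.1 hi b (h hb)

@[simp] theorem freeDirs_empty : freeDirs (∅ : Set (FacetLabel ι)) = Finset.univ := by
  ext; simp [mem_freeDirs]

theorem freeDirs_insert [DecidableEq ι] (k : FacetLabel ι) (T : Set (FacetLabel ι)) :
    freeDirs (insert k T) = (freeDirs T).erase k.1 := by
  ext i
  simp only [mem_freeDirs, Set.mem_insert_iff, not_or, Finset.mem_erase, forall_and,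
    Prod.ext_iff, not_and]
  exact and_congr_left fun _ => ⟨fun h hi => h k.2 hi rfl, fun h _ hi => absurd hi h⟩

theorem Consistent.insert {T : Set (FacetLabel ι)} (hT : Consistent T) {k : FacetLabel ι}
    (hk : k.1 ∈ freeDirs T) : Consistent (insert k T) := by
  rw [mem_freeDirs] at hk
  rintro l (rfl | hl) (hl' | hl')
  · exact opp_ne _ hl'
  · exact hk _ hl'
  · exact hk l.2 (by simpa [← hl'] using hl)
  · exact hT l hl hl'

theorem Consistent.eq_of_subset_of_card_freeDirs_le {T T' : Set (FacetLabel ι)}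
    (hT' : Consistent T') (h : T ⊆ T') (hcard : (freeDirs T).card ≤ (freeDirs T').card) :
    T = T' := by
  refine h.antisymm fun k hk => ?_
  have hfree : k.1 ∉ freeDirs T := by
    rw [← Finset.eq_of_subset_of_card_le (freeDirs_anti h) hcard]
    exact notMem_freeDirs.2 ⟨k.2, hk⟩
  obtain ⟨b, hb⟩ := notMem_freeDirs.1 hfree
  rwa [hT'.eq_of_fst_eq hk (h hb) rfl]

end FreeDirs

end FacetLabel

end FacetLabels

section Polyhedra

variable {E κ : Type*} [NormedAddCommGroup E] [NormedSpace ℝ E]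

/-- The face of the polyhedron `{x | ∀ k, 0 ≤ g k x}` cut out by the equations `g k x = 0` with
`k ∈ T`. -/
def slackFace (g : κ → E →ᵃ[ℝ] ℝ) (T : Set κ) : Set E :=
  {x | (∀ k, 0 ≤ g k x) ∧ ∀ k ∈ T, g k x = 0}

/-- The labels of the inequalities `0 ≤ g k x` that are tight on all of `F`. -/
def activeSet (g : κ → E →ᵃ[ℝ] ℝ) (F : Set E) : Set κ := {k | ∀ x ∈ F, g k x = 0}

variable {g : κ → E →ᵃ[ℝ] ℝ} {T T' : Set κ} {F : Set E}

theorem slackFace_anti (h : T ⊆ T') : slackFace g T' ⊆ slackFace g T :=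
  fun _ hx => ⟨hx.1, fun k hk => hx.2 k (h hk)⟩

theorem slackFace_subset_slackFace_empty : slackFace g T ⊆ slackFace g ∅ :=
  slackFace_anti (Set.empty_subset T)

theorem slackFace_inter (T T' : Set κ) :
    slackFace g T ∩ slackFace g T' = slackFace g (T ∪ T') := by
  ext x
  simp only [slackFace, Set.mem_inter_iff, Set.mem_ofPred_eq, Set.mem_union, or_imp, forall_and]
  tauto

theorem subset_slackFace_iff (hF : F ⊆ slackFace g ∅) : F ⊆ slackFace g T ↔ T ⊆ activeSet g F :=
  ⟨fun h _ hk _ hx => (h hx).2 _ hk, fun h _ hx => ⟨(hF hx).1, fun _ hk => h hk _ hx⟩⟩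

@[simp] theorem activeSet_empty : activeSet g ∅ = Set.univ := by
  ext; simp [activeSet]

theorem convex_slackFace (T : Set κ) : Convex ℝ (slackFace g T) := by
  intro x hx y hy a b ha hb hab
  have hg (k : κ) : g k (a • x + b • y) = a * g k x + b * g k y :=
    Convex.combo_affine_apply hab
  refine ⟨fun k => ?_, fun k hk => by rw [hg, hx.2 k hk, hy.2 k hk]; simp⟩
  rw [hg]
  exact add_nonneg (mul_nonneg ha (hx.1 k)) (mul_nonneg hb (hy.1 k))

variable [Finite κ]

-- A point of `F` with the fewest tight inequalities works: otherwise its midpoint with a suitable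
-- point of `F` has fewer.
theorem exists_mem_activeSet_of_eq_zero (hconv : Convex ℝ F) (hne : F.Nonempty)
    (hF : F ⊆ slackFace g ∅) : ∃ x ∈ F, ∀ k, g k x = 0 → k ∈ activeSet g F := by
  obtain ⟨x, hx, hmin⟩ := exists_minimalFor_of_wellFoundedLT (· ∈ F) (fun x => {k | g k x = 0}) hne
  refine ⟨x, hx, fun k hk y hy => ?_⟩
  have hmid (l : κ) : g l (midpoint ℝ x y) = 0 ↔ g l x = 0 ∧ g l y = 0 := by
    rw [AffineMap.map_midpoint, midpoint_eq_smul_add, smul_eq_zero_iff_right (by norm_num),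
      add_eq_zero_iff_of_nonneg ((hF hx).1 l) ((hF hy).1 l)]
  have hle := hmin (hconv.midpoint_mem hx hy) fun l hl => ((hmid l).1 hl).1
  exact ((hmid k).1 (hle hk)).2

theorem exists_neg_lineMap_mem_slackFace {x y : E} (hx : x ∈ slackFace g ∅)
    (h : ∀ k, g k x = 0 → g k y = 0) :
    ∃ t < (0 : ℝ), AffineMap.lineMap x y t ∈ slackFace g {k | g k x = 0} := by
  have hpos : ∀ᶠ t in nhdsWithin (0 : ℝ) (Set.Iio 0), ∀ k, g k x ≠ 0 →
      0 < AffineMap.lineMap (g k x) (g k y) t := by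
    refine Filter.Eventually.filter_mono nhdsWithin_le_nhds (Filter.eventually_all.2 fun k => ?_)
    refine Filter.eventually_imp_distrib_left.2 fun hk => ?_
    refine (AffineMap.lineMap_continuous.continuousAt).eventually_const_lt ?_
    simpa using (hx.1 k).lt_of_ne' hk
  obtain ⟨t, ht, ht0⟩ := (hpos.and self_mem_nhdsWithin).exists
  have hzero (k : κ) (hk : g k x = 0) : g k (AffineMap.lineMap x y t) = 0 := by
    simp [AffineMap.apply_lineMap, hk, h k hk]
  refine ⟨t, ht0, fun k => ?_, hzero⟩
  by_cases hk : g k x = 0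
  · exact (hzero k hk).ge
  · exact (AffineMap.apply_lineMap (g k) x y t ▸ ht k hk).le

-- The segment from a point of `slackFace g (activeSet g F)` to a point of `F` with the fewest tight
-- inequalities can be prolonged inside the polyhedron, so a functional maximal at the latter is
-- maximal at the former.
theorem slackFace_activeSet_of_isExposed (hF : IsExposed ℝ (slackFace g T) F) (hne : F.Nonempty) :
    slackFace g (activeSet g F) = F := by
  have hF0 : F ⊆ slackFace g ∅ := hF.subset.trans slackFace_subset_slackFace_empty
  refine Set.Subset.antisymm (fun y hy => ?_) ((subset_slackFace_iff hF0).2 le_rfl)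
  have hT : T ⊆ activeSet g F := (subset_slackFace_iff hF0).1 hF.subset
  obtain ⟨x, hx, hxF⟩ := exists_mem_activeSet_of_eq_zero (hF.convex (convex_slackFace T)) hne hF0
  obtain ⟨t, ht, hz⟩ := exists_neg_lineMap_mem_slackFace (hF0 hx) fun k hk => hy.2 k (hxF k hk)
  have hzT : AffineMap.lineMap x y t ∈ slackFace g T := slackFace_anti (fun k hk => hT hk x hx) hz
  obtain ⟨l, rfl⟩ := hF hne
  have hxy : l x ≤ l y := by
    have hlz := hx.2 _ hzT
    rw [AffineMap.lineMap_apply_module', map_add, map_smul, map_sub, smul_eq_mul] at hlz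
    nlinarith
  exact ⟨slackFace_anti hT hy, fun w hw => (hx.2 w hw).trans hxy⟩

variable [FiniteDimensional ℝ E]

theorem isExposed_setOf_affineMap_eq_zero {A : Set E} {f : E →ᵃ[ℝ] ℝ} (hf : ∀ x ∈ A, 0 ≤ f x) :
    IsExposed ℝ A {x ∈ A | f x = 0} := by
  rintro ⟨z, hzA, hz⟩
  have hlin (x y : E) : f.linear x ≤ f.linear y ↔ f x ≤ f y := by
    rw [← sub_nonneg, ← map_sub, ← sub_nonneg (b := f x)]
    exact (congrArg (0 ≤ ·) (f.linearMap_vsub y x)).to_iff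
  refine ⟨LinearMap.toContinuousLinearMap (-f.linear),
    Set.ext fun x => and_congr_right fun hx => ?_⟩
  simp only [LinearMap.coe_toContinuousLinearMap', LinearMap.neg_apply, neg_le_neg_iff, hlin]
  exact ⟨fun h y hy => h ▸ hf y hy, fun h => ((h z hzA).trans_eq hz).antisymm (hf x hx)⟩

theorem isExposed_slackFace (h : T ⊆ T') : IsExposed ℝ (slackFace g T) (slackFace g T') := by
  suffices key : IsExposed ℝ (slackFace g T) (slackFace g (T ∪ T')) by
    rwa [Set.union_eq_self_of_subset_left h] at key
  clear h
  induction T', T'.toFinite using Set.Finite.induction_on_subset with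
  | empty => simpa using IsExposed.refl (slackFace g T)
  | @insert k U _ _ _ ih =>
    have hinter : slackFace g (T ∪ insert k U) =
        slackFace g (T ∪ U) ∩ {x ∈ slackFace g T | g k x = 0} := by
      ext x
      simp only [slackFace, Set.mem_inter_iff, Set.mem_ofPred_eq, Set.mem_union,
        Set.mem_insert_iff, or_imp, forall_and, forall_eq]
      tauto
    rw [hinter]
    exact ih.inter (isExposed_setOf_affineMap_eq_zero fun x hx => hx.1 k)

theorem mem_interior_slackFace_empty {x : E} (hx : ∀ k, 0 < g k x) :
    x ∈ interior (slackFace g ∅) := by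
  have hopen : IsOpen (⋂ k, {y | 0 < g k y}) := isOpen_iInter_of_finite fun k =>
    isOpen_lt continuous_const (AffineMap.continuous_of_finiteDimensional (g k))
  have hsub : (⋂ k, {y | 0 < g k y}) ⊆ slackFace g ∅ := fun y hy =>
    ⟨fun k => (Set.mem_iInter.1 hy k).le, by simp⟩
  exact interior_maximal hsub hopen (Set.mem_iInter.2 hx)

end Polyhedra

open FacetLabel

section CubeSystems

/-- A combinatorial cube presented by inequalities and vertices: `2 * card ι` affine functionals,
in opposite pairs, on a space of dimension `card ι`, and `2 ^ card ι` points lying on the facets of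
the polyhedron `{x | ∀ k, 0 ≤ slack k x}` as the vertices of `[0, 1] ^ ι` do. -/
structure CubeSystem (ι E : Type*) [Fintype ι] [AddCommGroup E] [Module ℝ E] where
  /-- The functional that vanishes on the facet labelled `k` and is positive off it. -/
  slack : FacetLabel ι → E →ᵃ[ℝ] ℝ
  /-- The vertex lying on the facets `(i, s i)`. -/
  vertex : (ι → Bool) → E
  slack_self : ∀ s i, slack (i, s i) (vertex s) = 0
  slack_not_pos : ∀ s i, 0 < slack (i, !s i) (vertex s)
  finrank_eq : Module.finrank ℝ E = Fintype.card ι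

namespace CubeSystem

variable {ι E : Type*} [Fintype ι] [NormedAddCommGroup E] [NormedSpace ℝ E] (S : CubeSystem ι E)

/-- The intersection of the facets with labels in `T`. -/
abbrev face (T : Set (FacetLabel ι)) : Set E := slackFace S.slack T

theorem slack_vertex_nonneg (k : FacetLabel ι) (s : ι → Bool) : 0 ≤ S.slack k (S.vertex s) := by
  obtain ⟨i, b⟩ := k
  rcases Bool.eq_or_eq_not b (s i) with rfl | rfl
  exacts [(S.slack_self s i).ge, (S.slack_not_pos s i).le]

theorem slack_vertex_eq_zero_iff {k : FacetLabel ι} {s : ι → Bool} :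
    S.slack k (S.vertex s) = 0 ↔ s k.1 = k.2 := by
  obtain ⟨i, b⟩ := k
  rcases Bool.eq_or_eq_not b (s i) with rfl | rfl
  · simp [S.slack_self]
  · simpa using (S.slack_not_pos s i).ne'

theorem vertex_mem_face_iff {T : Set (FacetLabel ι)} {s : ι → Bool} :
    S.vertex s ∈ S.face T ↔ ∀ k ∈ T, s k.1 = k.2 := by
  simp only [slackFace, Set.mem_ofPred_eq, S.slack_vertex_nonneg, implies_true, true_and,
    S.slack_vertex_eq_zero_iff]

theorem face_nonempty {T : Set (FacetLabel ι)} (hT : Consistent T) : (S.face T).Nonempty :=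
  let ⟨s, hs⟩ := hT.exists_vertex
  ⟨S.vertex s, S.vertex_mem_face_iff.2 hs⟩

theorem exists_vertex_mem_face_slack_ne_zero {T : Set (FacetLabel ι)} (hT : Consistent T)
    {k : FacetLabel ι} (hk : k ∉ T) : ∃ s, S.vertex s ∈ S.face T ∧ S.slack k (S.vertex s) ≠ 0 := by
  classical
  obtain ⟨s, hs⟩ := hT.exists_vertex
  rw [← S.vertex_mem_face_iff] at hs
  by_cases hsk : S.slack k (S.vertex s) = 0
  · refine ⟨Function.update s k.1 (!k.2), S.vertex_mem_face_iff.2 fun l hl => ?_, ?_⟩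
    · have hlk : l.1 ≠ k.1 := fun h => hk <| by
        rwa [Prod.ext h ?_] at hl
        rw [← S.vertex_mem_face_iff.1 hs l hl, h, S.slack_vertex_eq_zero_iff.1 hsk]
      rw [Function.update_of_ne hlk, S.vertex_mem_face_iff.1 hs l hl]
    · simp [S.slack_vertex_eq_zero_iff]
  · exact ⟨s, hs, hsk⟩

theorem activeSet_face {T : Set (FacetLabel ι)} (hT : Consistent T) :
    activeSet S.slack (S.face T) = T := by
  refine Set.Subset.antisymm (fun k hk => ?_) fun k hk x hx => hx.2 k hk
  by_contra hkT
  obtain ⟨s, hs, hsk⟩ := S.exists_vertex_mem_face_slack_ne_zero hT hkT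
  exact hsk (hk _ hs)

theorem face_subset_face_iff {T T' : Set (FacetLabel ι)} (hT : Consistent T) :
    S.face T ⊆ S.face T' ↔ T' ⊆ T := by
  rw [subset_slackFace_iff slackFace_subset_slackFace_empty, S.activeSet_face hT]

theorem face_injOn : Set.InjOn S.face {T | Consistent T} := fun _ hT _ hT' h =>
  ((S.face_subset_face_iff hT').1 h.ge).antisymm ((S.face_subset_face_iff hT).1 h.le)

theorem face_singleton_injective : Function.Injective fun k => S.face {k} := fun k l h =>
  Set.singleton_injective (S.face_injOn (consistent_singleton k) (consistent_singleton l) h)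

section Edges

variable [DecidableEq ι]

/-- The edge direction from `vertex s` along coordinate `j`, scaled to be dual to the slack
functionals of the facets through `vertex s`. -/
noncomputable def edge (s : ι → Bool) (j : ι) : E :=
  (S.slack (j, s j) (S.vertex (Function.update s j (!s j))))⁻¹ •
    (S.vertex (Function.update s j (!s j)) - S.vertex s)

theorem slack_linear_edge (s : ι → Bool) (i j : ι) :
    (S.slack (i, s i)).linear (S.edge s j) = if i = j then 1 else 0 := by
  have hsub : (S.slack (i, s i)).linear (S.vertex (Function.update s j (!s j)) - S.vertex s) =
      S.slack (i, s i) (S.vertex (Function.update s j (!s j))) := by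
    rw [← vsub_eq_sub, AffineMap.linearMap_vsub, S.slack_self, vsub_eq_sub, sub_zero]
  rw [edge, map_smul, hsub, smul_eq_mul]
  split_ifs with h
  · subst h
    exact inv_mul_cancel₀ (by simp [S.slack_vertex_eq_zero_iff])
  · have hzero : S.slack (i, s i) (S.vertex (Function.update s j (!s j))) = 0 :=
      S.slack_vertex_eq_zero_iff.2 (Function.update_of_ne h _ _)
    rw [hzero, mul_zero]

theorem linearIndependent_edge (s : ι → Bool) : LinearIndependent ℝ (S.edge s) :=
  .of_pairwise_dual_eq_zero_one _ (fun i => (S.slack (i, s i)).linear)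
    (fun i j hij => (S.slack_linear_edge s i j).trans (if_neg hij))
    fun i => (S.slack_linear_edge s i i).trans (if_pos rfl)

variable [FiniteDimensional ℝ E]

theorem eq_sum_smul_edge (s : ι → Bool) (u : E) :
    u = ∑ j, (S.slack (j, s j)).linear u • S.edge s j := by
  have hspan := (S.linearIndependent_edge s).span_eq_top_of_card_eq_finrank' S.finrank_eq.symm
  obtain ⟨c, rfl⟩ := (Submodule.mem_span_range_iff_exists_fun ℝ).1
    (hspan ▸ Submodule.mem_top : u ∈ Submodule.span ℝ (Set.range (S.edge s)))
  simp [S.slack_linear_edge]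

theorem sub_vertex_eq_sum_smul_edge (s : ι → Bool) (x : E) :
    x - S.vertex s = ∑ j, S.slack (j, s j) x • S.edge s j := by
  conv_lhs => rw [S.eq_sum_smul_edge s (x - S.vertex s)]
  refine Finset.sum_congr rfl fun j _ => ?_
  rw [← vsub_eq_sub, AffineMap.linearMap_vsub, S.slack_self, vsub_eq_sub, sub_zero]

theorem vectorSpan_face {T : Set (FacetLabel ι)} {s : ι → Bool} (hs : S.vertex s ∈ S.face T) :
    vectorSpan ℝ (S.face T) = Submodule.span ℝ (S.edge s '' freeDirs T) := by
  have hsT := S.vertex_mem_face_iff.1 hs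
  apply le_antisymm
  · rw [vectorSpan_eq_span_vsub_set_right ℝ hs, Submodule.span_le]
    rintro _ ⟨x, hx, rfl⟩
    change x - S.vertex s ∈ _
    rw [S.sub_vertex_eq_sum_smul_edge s x]
    refine Submodule.sum_mem _ fun j _ => ?_
    by_cases hj : j ∈ freeDirs T
    · exact Submodule.smul_mem _ _ (Submodule.subset_span ⟨j, hj, rfl⟩)
    · obtain ⟨b, hb⟩ := notMem_freeDirs.1 hj
      have hzero : S.slack (j, s j) x = 0 := hx.2 _ ((hsT _ hb : s j = b) ▸ hb)
      simp [hzero]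
  · rw [Submodule.span_le]
    rintro _ ⟨j, hj, rfl⟩
    refine Submodule.smul_mem _ _
      (vsub_mem_vectorSpan ℝ (S.vertex_mem_face_iff.2 fun k hk => ?_) hs)
    have hkj : k.1 ≠ j := fun h => mem_freeDirs.1 hj k.2 (h ▸ hk)
    rw [Function.update_of_ne hkj, hsT k hk]

end Edges

variable [FiniteDimensional ℝ E]

theorem affDim_face {T : Set (FacetLabel ι)} (hT : Consistent T) :
    affDim (S.face T) = (freeDirs T).card := by
  classical
  obtain ⟨s, hs⟩ := hT.exists_vertex
  have hli := (S.linearIndependent_edge s).comp ((↑) : freeDirs T → ι) Subtype.val_injective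
  rw [affDim, S.vectorSpan_face (S.vertex_mem_face_iff.2 hs), Set.image_eq_range]
  exact (finrank_span_eq_card hli).trans (Fintype.card_coe _)

theorem mem_affineSpan_face_singleton_iff {k : FacetLabel ι} {x : E} :
    x ∈ affineSpan ℝ (S.face {k}) ↔ S.slack k x = 0 := by
  classical
  obtain ⟨s, hs⟩ := (consistent_singleton k).exists_vertex
  rw [← S.vertex_mem_face_iff] at hs
  constructor
  · intro hx
    have himage := AffineSubspace.mem_map_of_mem (S.slack k) hx
    rw [AffineSubspace.map_span] at himage
    have hsub : S.slack k '' S.face {k} ⊆ {0} := by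
      rintro _ ⟨y, hy, rfl⟩
      exact hy.2 k rfl
    simpa using affineSpan_mono ℝ hsub himage
  · intro hx
    rw [← AffineSubspace.vsub_right_mem_direction_iff_mem (subset_affineSpan ℝ _ hs),
      direction_affineSpan, S.vectorSpan_face hs, vsub_eq_sub, S.sub_vertex_eq_sum_smul_edge s x]
    refine Submodule.sum_mem _ fun j _ => ?_
    by_cases hj : j ∈ freeDirs {k}
    · exact Submodule.smul_mem _ _ (Submodule.subset_span ⟨j, hj, rfl⟩)
    · obtain ⟨b, rfl⟩ := notMem_freeDirs.1 hj
      have hsj : s j = b := S.vertex_mem_face_iff.1 hs _ rfl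
      simp [hsj, hx]

-- A functional maximal at a vertex among all vertices decreases along the edges at that vertex,
-- hence is maximal there on the whole polyhedron; so no functional separates a point of the
-- polyhedron from the hull of the vertices.
theorem face_empty_eq_convexHull : S.face ∅ = convexHull ℝ (Set.range S.vertex) := by
  classical
  refine Set.Subset.antisymm (fun x hx => ?_) (convexHull_min ?_ (convex_slackFace ∅))
  · by_contra hxc
    obtain ⟨l, u, hl, hux⟩ := geometric_hahn_banach_closed_point
      (convex_convexHull ℝ (Set.range S.vertex))
      ((Set.finite_range S.vertex).isCompact_convexHull ℝ).isClosed hxc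
    obtain ⟨s, hs⟩ := Finite.exists_max fun s => l (S.vertex s)
    have hedge (j : ι) : l (S.edge s j) ≤ 0 := by
      rw [edge, map_smul, map_sub, smul_eq_mul]
      exact mul_nonpos_of_nonneg_of_nonpos (inv_nonneg.2 (S.slack_vertex_nonneg _ _))
        (sub_nonpos.2 (hs _))
    have hmax : l (x - S.vertex s) ≤ 0 := by
      rw [S.sub_vertex_eq_sum_smul_edge s x, map_sum]
      refine Finset.sum_nonpos fun j _ => ?_
      rw [map_smul, smul_eq_mul]
      exact mul_nonpos_of_nonneg_of_nonpos (hx.1 _) (hedge j)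
    have hsu := hl (S.vertex s) (subset_convexHull ℝ _ ⟨s, rfl⟩)
    rw [map_sub] at hmax
    linarith
  · rintro _ ⟨s, rfl⟩
    exact S.vertex_mem_face_iff.2 (by simp)

theorem isPolytope_face_empty : IsPolytope (S.face ∅) :=
  ⟨(Set.finite_range S.vertex).toFinset, by simpa using S.face_empty_eq_convexHull⟩

theorem slack_add_slack_opp_pos {x : E} (hx : x ∈ S.face ∅) (k : FacetLabel ι) :
    0 < S.slack k x + S.slack (opp k) x := by
  have hconv : Convex ℝ {y | 0 < (S.slack k + S.slack (opp k)) y} :=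
    (convex_Ioi (0 : ℝ)).affine_preimage _
  rw [S.face_empty_eq_convexHull] at hx
  refine convexHull_min ?_ hconv hx
  rintro _ ⟨s, rfl⟩
  have hne : S.slack k (S.vertex s) + S.slack (opp k) (S.vertex s) ≠ 0 := by
    rw [Ne, add_eq_zero_iff_of_nonneg (S.slack_vertex_nonneg _ _) (S.slack_vertex_nonneg _ _),
      S.slack_vertex_eq_zero_iff, S.slack_vertex_eq_zero_iff]
    rintro ⟨h, h'⟩
    simp [opp, h] at h'
  exact (add_nonneg (S.slack_vertex_nonneg _ _) (S.slack_vertex_nonneg _ _)).lt_of_ne' hne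

theorem face_nonempty_iff {T : Set (FacetLabel ι)} : (S.face T).Nonempty ↔ Consistent T := by
  refine ⟨?_, S.face_nonempty⟩
  rintro ⟨x, hx⟩ k hk hk'
  have hpos := S.slack_add_slack_opp_pos (slackFace_subset_slackFace_empty hx) k
  rw [hx.2 k hk, hx.2 _ hk', add_zero] at hpos
  exact hpos.false

theorem isFacet_face_iff {T : Set (FacetLabel ι)} (hT : Consistent T) {F : Set E} :
    IsFacet (S.face T) F ↔ ∃ k : FacetLabel ι, k.1 ∈ freeDirs T ∧ F = S.face (insert k T) := by
  classical
  constructor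
  · rintro ⟨hexp, hne, hdim⟩
    have hF : S.face (activeSet S.slack F) = F := slackFace_activeSet_of_isExposed hexp hne
    set T' := activeSet S.slack F
    have hTT' : T ⊆ T' :=
      (subset_slackFace_iff (hexp.subset.trans slackFace_subset_slackFace_empty)).1 hexp.subset
    have hT' : Consistent T' := S.face_nonempty_iff.1 (hF ▸ hne)
    rw [← hF, S.affDim_face hT', S.affDim_face hT] at hdim
    obtain ⟨i, hi, hi'⟩ := Finset.exists_mem_notMem_of_card_lt_card (Nat.lt_of_succ_le hdim.le)
    obtain ⟨b, hb⟩ := notMem_freeDirs.1 hi'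
    refine ⟨(i, b), hi, ?_⟩
    rw [← hF, hT'.eq_of_subset_of_card_freeDirs_le (Set.insert_subset hb hTT') ?_]
    rw [freeDirs_insert, Finset.card_erase_of_mem hi, ← hdim, Nat.add_sub_cancel]
  · rintro ⟨k, hk, rfl⟩
    have hT' := hT.insert hk
    refine ⟨isExposed_slackFace (Set.subset_insert k T), S.face_nonempty hT', ?_⟩
    rw [S.affDim_face hT', S.affDim_face hT, freeDirs_insert, Finset.card_erase_add_one hk]

theorem isFacet_face_empty_iff {F : Set E} : IsFacet (S.face ∅) F ↔ ∃ k, F = S.face {k} := by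
  simp [S.isFacet_face_iff consistent_empty]

section FaceLattice

variable [Nonempty ι]

theorem face_univ : S.face Set.univ = ∅ :=
  Set.not_nonempty_iff_eq_empty.1 (S.face_nonempty_iff.not.2 not_consistent_univ)

theorem face_activeSet {T : Set (FacetLabel ι)} {F : Set E} (hF : IsExposed ℝ (S.face T) F) :
    S.face (activeSet S.slack F) = F := by
  rcases F.eq_empty_or_nonempty with rfl | hne
  · rw [activeSet_empty, S.face_univ]
  · exact slackFace_activeSet_of_isExposed hF hne

/-- The face lattice of a cube, read off from labels: a nonempty face corresponds to the consistent
set of the facets that contain it, and the empty face to the set of all labels. -/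
def faceOrderIso :
    Face (S.face ∅) ≃o {T : Set (FacetLabel ι) // Consistent T ∨ T = Set.univ}ᵒᵈ where
  toFun F := OrderDual.toDual ⟨activeSet S.slack F, by
    rcases F.1.eq_empty_or_nonempty with hF | hF
    · exact Or.inr (hF ▸ activeSet_empty)
    · exact Or.inl (S.face_nonempty_iff.1 ((S.face_activeSet F.2).symm ▸ hF))⟩
  invFun T := ⟨S.face T.ofDual, isExposed_slackFace (Set.empty_subset _)⟩
  left_inv F := Subtype.ext (S.face_activeSet F.2)
  right_inv := by
    rintro ⟨T, hT | rfl⟩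
    · exact congrArg OrderDual.toDual (Subtype.ext (S.activeSet_face hT))
    · have hempty : activeSet S.slack (S.face Set.univ) = Set.univ := by
        rw [S.face_univ, activeSet_empty]
      exact congrArg OrderDual.toDual (Subtype.ext hempty)
  map_rel_iff' {F G} := by
    have hiff : F.1 ⊆ S.face (activeSet S.slack G) ↔ _ := subset_slackFace_iff F.2.subset
    rw [S.face_activeSet G.2] at hiff
    exact hiff.symm

theorem coe_faceOrderIso_symm_faceOrderIso {E' : Type*} [NormedAddCommGroup E']
    [NormedSpace ℝ E'] [FiniteDimensional ℝ E'] (S' : CubeSystem ι E') {T : Set (FacetLabel ι)}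
    (hT : Consistent T) (hF : IsExposed ℝ (S.face ∅) (S.face T)) :
    ((S.faceOrderIso.trans S'.faceOrderIso.symm ⟨S.face T, hF⟩ : Face (S'.face ∅)) : Set E') =
      S'.face T :=
  congrArg S'.face (S.activeSet_face hT)

end FaceLattice

end CubeSystem

end CubeSystems

section Prefixes

variable {α : Type*}

/-- The set of the first `m` members of a list. -/
def prefixSet (l : List α) (m : ℕ) : Set α := {a | a ∈ l.take m}

@[simp] theorem prefixSet_zero (l : List α) : prefixSet l 0 = ∅ := by simp [prefixSet]

theorem prefixSet_of_length_le {l : List α} {m : ℕ} (h : l.length ≤ m) :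
    prefixSet l m = {a | a ∈ l} := by rw [prefixSet, List.take_of_length_le h]

theorem prefixSet_succ {l : List α} {j : ℕ} (hj : j < l.length) :
    prefixSet l (j + 1) = insert l[j] (prefixSet l j) := by
  ext a
  rw [prefixSet, List.take_succ_eq_append_getElem hj]
  exact List.mem_append.trans (or_comm.trans (or_congr_left List.mem_singleton))

theorem prefixSet_subset (l : List α) (m : ℕ) : prefixSet l m ⊆ {a | a ∈ l} :=
  fun _ => List.mem_of_mem_take

theorem getElem_notMem_prefixSet {l : List α} (h : l.Nodup) {j : ℕ}
    (hj : j < l.length) : l[j] ∉ prefixSet l j := by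
  intro hmem
  obtain ⟨i, hi, hij⟩ := List.mem_take_iff_getElem.1 hmem
  have := (h.getElem_inj_iff).1 hij
  omega

end Prefixes

section IndecomposableOrderings

namespace FacetLabel

variable {ι : Type*}

/-- `l` lists once each of the facet labels with directions in `U`. -/
def Enumerates (U : Finset ι) (l : List (FacetLabel ι)) : Prop :=
  l.Nodup ∧ ∀ k, k ∈ l ↔ k.1 ∈ U

theorem Enumerates.length_eq {U : Finset ι} {l : List (FacetLabel ι)} (hl : Enumerates U l) :
    l.length = 2 * U.card := by
  classical
  have htoFinset : l.toFinset = U ×ˢ (Finset.univ : Finset Bool) := by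
    ext k
    simp [hl.2 k]
  rw [← List.toFinset_card_of_nodup hl.1, htoFinset, Finset.card_product, mul_comm]
  rfl

/-- Closure under passing to the opposite facet. -/
def OppClosed (A : Set (FacetLabel ι)) : Prop := ∀ k ∈ A, opp k ∈ A

/-- The orderings of facet labels that turn out to be the shellings: no proper nonempty initial
segment consists of pairs of opposite facets. -/
def Indecomposable (l : List (FacetLabel ι)) : Prop :=
  ∀ m, 0 < m → m < l.length → ¬ OppClosed (prefixSet l m)

theorem indecomposable_cons_concat_opp {a : FacetLabel ι} {l : List (FacetLabel ι)}
    (h : opp a ∉ l) : Indecomposable (a :: (l ++ [opp a])) := by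
  intro m hm hml hclosed
  obtain ⟨m, rfl⟩ := Nat.exists_eq_add_one_of_ne_zero hm.ne'
  simp only [List.length_cons, List.length_append, List.length_nil] at hml
  have hinit : prefixSet (a :: (l ++ [opp a])) (m + 1) = insert a (prefixSet l m) := by
    ext k
    simp [prefixSet, List.take_append_of_le_length (show m ≤ l.length by omega)]
  rw [hinit] at hclosed
  rcases hclosed a (Or.inl rfl) with h' | h'
  exacts [opp_ne a h', h (prefixSet_subset l m h')]

theorem Enumerates.indecomposable_of_card_eq_one {U : Finset ι} {l : List (FacetLabel ι)}
    (hl : Enumerates U l) (hU : U.card = 1) : Indecomposable l := by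
  intro m hm hml hclosed
  have hlen := hl.length_eq
  obtain rfl : m = 0 + 1 := by omega
  rw [prefixSet_succ (by omega), prefixSet_zero] at hclosed
  exact opp_ne _ (by simpa using hclosed _ (Or.inl rfl))

theorem Indecomposable.prefixSet_eq_of_oppClosed {U : Finset ι} {g : List (FacetLabel ι)}
    (hg : Enumerates U g) (hgi : Indecomposable g) {r : ℕ} (h : OppClosed (prefixSet g r)) :
    prefixSet g r = ∅ ∨ prefixSet g r = {k | k.1 ∈ U} := by
  rcases Nat.eq_zero_or_pos r with rfl | hr
  · exact Or.inl (prefixSet_zero g)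
  · refine Or.inr ((prefixSet_of_length_le ?_).trans (Set.ext hg.2))
    exact not_lt.1 fun hlt => hgi r hr hlt h

theorem oppClosed_setOf_fst_ne {A : Set (FacetLabel ι)} (h : OppClosed A) (i : ι) :
    OppClosed {k ∈ A | k.1 ≠ i} := fun k hk => ⟨h k hk.1, hk.2⟩

theorem OppClosed.of_setOf_fst_ne {A : Set (FacetLabel ι)} {i : ι}
    (h : OppClosed {k ∈ A | k.1 ≠ i}) (hi : ∀ b, (i, b) ∈ A → (i, !b) ∈ A) : OppClosed A := by
  rintro ⟨j, b⟩ hk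
  by_cases hj : j = i
  · exact hj ▸ hi b (hj ▸ hk)
  · exact (h (j, b) ⟨hk, hj⟩).1

theorem setOf_insert_fst_ne (A : Set (FacetLabel ι)) (a : FacetLabel ι) :
    {k ∈ insert a A | k.1 ≠ a.1} = {k ∈ A | k.1 ≠ a.1} := by
  ext k
  simp only [Set.mem_insert_iff, Set.mem_ofPred_eq]
  exact ⟨fun h => ⟨h.1.resolve_left fun hk => h.2 (congrArg Prod.fst hk), h.2⟩,
    fun h => ⟨Or.inr h.1, h.2⟩⟩

theorem oppClosed_or_oppClosed_insert {A : Set (FacetLabel ι)} {a : FacetLabel ι} (ha : a ∉ A)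
    (h : OppClosed {k ∈ A | k.1 ≠ a.1}) : OppClosed A ∨ OppClosed (insert a A) := by
  have hdir {b : Bool} (hb : (a.1, b) ∈ A) : (a.1, b) = opp a :=
    (eq_or_eq_opp (k := (a.1, b)) (l := a) rfl).resolve_left fun h => ha (h ▸ hb)
  by_cases ha' : opp a ∈ A
  · refine Or.inr (OppClosed.of_setOf_fst_ne (i := a.1) (setOf_insert_fst_ne A a ▸ h) fun b _ => ?_)
    rcases eq_or_eq_opp (k := (a.1, !b)) (l := a) rfl with hb | hb
    exacts [Or.inl hb, Or.inr (hb ▸ ha')]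
  · exact Or.inl (h.of_setOf_fst_ne fun b hb => absurd (hdir hb ▸ hb) ha')

-- List `a` first, then the rest of `A`, then the labels outside `A`, with `opp a` last.
theorem exists_indecomposable_prefixSet_eq_of_opp_notMem {U : Finset ι} {A : Set (FacetLabel ι)}
    (hA : ∀ k ∈ A, k.1 ∈ U) {a : FacetLabel ι} (ha : a ∈ A) (ha' : opp a ∉ A) :
    ∃ g, Enumerates U g ∧ Indecomposable g ∧ ∃ r ≤ g.length, prefixSet g r = A := by
  classical
  let l₁ := (Finset.filter (fun k => k ∈ A ∧ k ≠ a) (U ×ˢ Finset.univ)).toList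
  let l₂ := (Finset.filter (fun k => k ∉ A ∧ k ≠ opp a) (U ×ˢ Finset.univ)).toList
  have hl₁ (k : FacetLabel ι) : k ∈ l₁ ↔ k ∈ A ∧ k ≠ a := by
    simpa [l₁] using fun hk _ => hA k hk
  have hl₂ (k : FacetLabel ι) : k ∈ l₂ ↔ k.1 ∈ U ∧ k ∉ A ∧ k ≠ opp a := by simp [l₂]
  have haU : a.1 ∈ U := hA a ha
  refine ⟨a :: ((l₁ ++ l₂) ++ [opp a]), ⟨?_, fun k => ?_⟩, ?_, l₁.length + 1, ?_, ?_⟩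
  · have h₁ : l₁.Nodup := Finset.nodup_toList _
    have h₂ : l₂.Nodup := Finset.nodup_toList _
    have hne := opp_ne a
    simp only [List.nodup_cons, List.nodup_append, List.mem_append, List.mem_singleton, hl₁, hl₂]
    grind
  · have := opp_fst a
    simp only [List.mem_cons, List.mem_append, List.not_mem_nil, or_false, hl₁, hl₂]
    grind
  · exact indecomposable_cons_concat_opp (by simp [hl₁, hl₂, ha'])
  · simp only [List.length_cons, List.length_append]
    omega
  · ext k
    by_cases hk : k = a <;> simp [prefixSet, hl₁, hk, ha]

theorem exists_indecomposable_prefixSet_eq {U : Finset ι} (hU : U.Nonempty)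
    {A : Set (FacetLabel ι)} (hA : A ⊆ {k | k.1 ∈ U})
    (h : OppClosed A → A = ∅ ∨ A = {k | k.1 ∈ U}) :
    ∃ g, Enumerates U g ∧ Indecomposable g ∧ ∃ r ≤ g.length, prefixSet g r = A := by
  obtain ⟨i, hi⟩ := hU
  obtain ⟨g, hg, hgi, -⟩ := exists_indecomposable_prefixSet_eq_of_opp_notMem
    (U := U) (A := {(i, true)}) (a := (i, true)) (by simpa using hi) rfl (opp_ne _)
  by_cases hclosed : OppClosed A
  · rcases h hclosed with rfl | rfl
    · exact ⟨g, hg, hgi, 0, Nat.zero_le _, prefixSet_zero g⟩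
    · exact ⟨g, hg, hgi, g.length, le_rfl, (prefixSet_of_length_le le_rfl).trans (Set.ext hg.2)⟩
  · simp only [OppClosed, not_forall] at hclosed
    obtain ⟨a, ha, ha'⟩ := hclosed
    exact exists_indecomposable_prefixSet_eq_of_opp_notMem hA ha ha'

variable [DecidableEq ι]

/-- The combinatorial form of the recursive condition on the `j`-th facet of a shelling: `A` stands
for the set of earlier facets, and the facets with direction `i` are those disjoint from the
`j`-th one. -/
def ShellingStep (U : Finset ι) (i : ι) (A : Set (FacetLabel ι)) : Prop :=
  ∃ g, Enumerates (U.erase i) g ∧ Indecomposable g ∧ ∃ r ≤ g.length,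
    prefixSet g r = {k ∈ A | k.1 ≠ i}

theorem shellingStep_iff {U : Finset ι} (hU : 2 ≤ U.card) {i : ι} {A : Set (FacetLabel ι)}
    (hA : A ⊆ {k | k.1 ∈ U}) :
    ShellingStep U i A ↔ (OppClosed {k ∈ A | k.1 ≠ i} →
      {k ∈ A | k.1 ≠ i} = ∅ ∨ {k ∈ A | k.1 ≠ i} = {k | k.1 ∈ U.erase i}) := by
  constructor
  · rintro ⟨g, hg, hgi, r, -, hr⟩
    rw [← hr]
    exact hgi.prefixSet_eq_of_oppClosed hg
  · refine exists_indecomposable_prefixSet_eq (Finset.card_pos.1 ?_) fun k hk => ?_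
    · have := Finset.pred_card_le_card_erase (s := U) (a := i)
      omega
    · exact Finset.mem_erase.2 ⟨hk.2, hA hk.1⟩

/- If the earlier labels outside the direction of `l[j]` are closed under `opp`, so is one of the
initial segments of length `j` and `j + 1`. -/
theorem Indecomposable.setOf_prefixSet_fst_ne_eq {U : Finset ι} {l : List (FacetLabel ι)}
    (hl : Enumerates U l) (hind : Indecomposable l) {j : ℕ} (hj0 : 0 < j) (hj : j < l.length)
    (hclosed : OppClosed {k ∈ prefixSet l j | k.1 ≠ l[j].1}) :
    {k ∈ prefixSet l j | k.1 ≠ l[j].1} = {k | k.1 ∈ U.erase l[j].1} := by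
  have hclosed_succ := (oppClosed_or_oppClosed_insert
    (getElem_notMem_prefixSet hl.1 hj) hclosed).resolve_left (hind j hj0 hj)
  rw [← prefixSet_succ hj] at hclosed_succ
  have hinit : prefixSet l (j + 1) = {k | k.1 ∈ U} :=
    (prefixSet_of_length_le (not_lt.1 fun h => hind _ (Nat.succ_pos j) h hclosed_succ)).trans
      (Set.ext hl.2)
  rw [← setOf_insert_fst_ne, ← prefixSet_succ hj, hinit]
  ext k
  simp [and_comm]

theorem not_oppClosed_prefixSet_succ {U : Finset ι} {l : List (FacetLabel ι)}
    (hl : Enumerates U l) {j : ℕ} (hj : j + 1 < l.length)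
    (h : OppClosed {k ∈ prefixSet l j | k.1 ≠ l[j].1} → 0 < j →
      {k ∈ prefixSet l j | k.1 ≠ l[j].1} = {k | k.1 ∈ U.erase l[j].1}) :
    ¬ OppClosed (prefixSet l (j + 1)) := by
  have hjl : j < l.length := by omega
  rw [prefixSet_succ hjl]
  intro hclosed
  have hopp : opp l[j] ∈ prefixSet l j := (hclosed _ (Or.inl rfl)).resolve_left (opp_ne _)
  have hj0 : 0 < j := Nat.pos_of_ne_zero fun h0 => by subst h0; simp at hopp
  have hall := h (setOf_insert_fst_ne _ l[j] ▸ oppClosed_setOf_fst_ne hclosed _) hj0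
  have hsubset : l ⊆ l.take (j + 1) := fun k hk => by
    change k ∈ prefixSet l (j + 1)
    rw [prefixSet_succ hjl]
    by_cases hkj : k.1 = l[j].1
    · rcases eq_or_eq_opp hkj with rfl | rfl
      exacts [Or.inl rfl, Or.inr hopp]
    · exact Or.inr (hall.ge (Finset.mem_erase.2 ⟨hkj, (hl.2 k).1 hk⟩)).1
  have hlen := (List.subperm_of_subset hl.1 hsubset).length_le
  rw [List.length_take] at hlen
  omega

theorem indecomposable_iff_shellingStep {U : Finset ι} (hU : 2 ≤ U.card) {l : List (FacetLabel ι)}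
    (hl : Enumerates U l) :
    Indecomposable l ↔ ∀ (j : ℕ) (hj : j < l.length),
      (0 < j → {k ∈ prefixSet l j | k.1 ≠ l[j].1}.Nonempty) ∧
        ShellingStep U l[j].1 (prefixSet l j) := by
  have hsub (m : ℕ) : prefixSet l m ⊆ {k | k.1 ∈ U} := fun k hk =>
    (hl.2 k).1 (prefixSet_subset l m hk)
  simp only [shellingStep_iff hU (hsub _)]
  refine ⟨fun hind j hj => ⟨fun hj0 => ?_, fun hclosed => ?_⟩, fun h m hm hml => ?_⟩
  · by_contra hempty
    rw [Set.not_nonempty_iff_eq_empty] at hempty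
    have hall := hind.setOf_prefixSet_fst_ne_eq hl hj0 hj (by simp [hempty, OppClosed])
    obtain ⟨i, hi⟩ : (U.erase l[j].1).Nonempty := Finset.card_pos.1 <| by
      have := Finset.pred_card_le_card_erase (s := U) (a := l[j].1)
      omega
    have hmem : ((i, true) : FacetLabel ι) ∈ {k : FacetLabel ι | k.1 ∈ U.erase l[j].1} := hi
    rw [← hall, hempty] at hmem
    exact hmem
  · rcases Nat.eq_zero_or_pos j with rfl | hj0
    exacts [Or.inl (by simp), Or.inr (hind.setOf_prefixSet_fst_ne_eq hl hj0 hj hclosed)]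
  · obtain ⟨j, rfl⟩ := Nat.exists_eq_add_one_of_ne_zero hm.ne'
    obtain ⟨hne, hstep⟩ := h j (by omega)
    exact not_oppClosed_prefixSet_succ hl hml fun hclosed hj0 =>
      (hstep hclosed).resolve_left (hne hj0).ne_empty

end FacetLabel

end IndecomposableOrderings

section ShellingsOfCubes

theorem nodup_and_mem_iff_exists_map {α β : Type*} {f : α → β} {s : Set α} (hf : Set.InjOn f s)
    {L : List β} :
    (L.Nodup ∧ ∀ b, b ∈ L ↔ b ∈ f '' s) ↔
      ∃ l : List α, (l.Nodup ∧ ∀ a, a ∈ l ↔ a ∈ s) ∧ L = l.map f := by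
  constructor
  · rintro ⟨hnodup, hmem⟩
    obtain ⟨l, rfl⟩ : L ∈ Set.range (List.map fun a : s => f a) := by
      rw [Set.range_list_map]
      intro b hb
      obtain ⟨a, ha, rfl⟩ := (hmem b).1 hb
      exact ⟨⟨a, ha⟩, rfl⟩
    refine ⟨l.map Subtype.val, ⟨(List.Nodup.of_map _ hnodup).map Subtype.val_injective,
      fun a => ⟨fun ha => ?_, fun ha => ?_⟩⟩, by simp⟩
    · obtain ⟨a', -, rfl⟩ := List.mem_map.1 ha
      exact a'.2
    · obtain ⟨a', ha', h⟩ := List.mem_map.1 ((hmem _).2 ⟨a, ha, rfl⟩)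
      exact List.mem_map.2 ⟨a', ha', hf a'.2 ha h⟩
  · rintro ⟨l, ⟨hnodup, hmem⟩, rfl⟩
    refine ⟨hnodup.map_on fun a ha b hb => hf ((hmem a).1 ha) ((hmem b).1 hb), fun b => ?_⟩
    simp only [List.mem_map, hmem, Set.mem_image]

namespace CubeSystem

variable {ι E : Type*} [Fintype ι] [NormedAddCommGroup E] [NormedSpace ℝ E] (S : CubeSystem ι E)

/-- The facets of `S.face T` with the given labels, which are supposed to have directions in
`freeDirs T`. -/
def facetList (T : Set (FacetLabel ι)) (l : List (FacetLabel ι)) : List (Set E) :=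
  l.map fun k => S.face (insert k T)

variable {S} {T : Set (FacetLabel ι)} {l : List (FacetLabel ι)}

@[simp] theorem length_facetList : (S.facetList T l).length = l.length := List.length_map _

theorem getElem_facetList {j : ℕ} (hj : j < (S.facetList T l).length) :
    (S.facetList T l)[j] = S.face (insert (l[j]'(length_facetList (S := S) ▸ hj)) T) :=
  List.getElem_map _

theorem prefixUnion_facetList (r : ℕ) :
    prefixUnion (S.facetList T l) r = ⋃ k ∈ prefixSet l r, S.face (insert k T) := by
  ext x
  simp only [prefixUnion, facetList, prefixSet, ← List.map_take, List.mem_map,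
    Set.mem_ofPred_eq, exists_exists_and_eq_and, Set.mem_iUnion₂, exists_prop]

theorem face_insert_injOn (hT : Consistent T) :
    Set.InjOn (fun k => S.face (insert k T)) {k | k.1 ∈ freeDirs T} := fun k hk l hl h => by
  have hkl : k ∈ insert l T := S.face_injOn (hT.insert hk) (hT.insert hl) h ▸ Set.mem_insert k T
  exact hkl.resolve_right fun h => mem_freeDirs.1 hk k.2 h

theorem biUnion_face_insert_injOn (hT : Consistent T) :
    Set.InjOn (fun A : Set (FacetLabel ι) => ⋃ k ∈ A, S.face (insert k T))
      {A | ∀ k ∈ A, k.1 ∈ freeDirs T} := by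
  suffices hsub : ∀ A B : Set (FacetLabel ι), (∀ k ∈ A, k.1 ∈ freeDirs T) →
      (∀ k ∈ B, k.1 ∈ freeDirs T) →
      ⋃ k ∈ A, S.face (insert k T) ⊆ ⋃ k ∈ B, S.face (insert k T) → A ⊆ B from
    fun A hA B hB h => (hsub A B hA hB (Set.Subset.antisymm_iff.1 h).1).antisymm
      (hsub B A hB hA (Set.Subset.antisymm_iff.1 h).2)
  intro A B hA hB h k hk
  have hkT := hT.insert (hA k hk)
  obtain ⟨x, hx, hgeneric⟩ := exists_mem_activeSet_of_eq_zero (convex_slackFace _)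
    (S.face_nonempty hkT) slackFace_subset_slackFace_empty
  rw [S.activeSet_face hkT] at hgeneric
  obtain ⟨k', hk', hxk'⟩ := Set.mem_iUnion₂.1 (h (Set.mem_biUnion hk hx))
  rcases hgeneric k' (hxk'.2 k' (Set.mem_insert _ _)) with rfl | hk'T
  · exact hk'
  · exact absurd hk'T (mem_freeDirs.1 (hB k' hk') k'.2)

variable [FiniteDimensional ℝ E]

theorem isFacetOrdering_face_iff (hT : Consistent T) {L : List (Set E)} :
    IsFacetOrdering (S.face T) L ↔ ∃ l, Enumerates (freeDirs T) l ∧ L = S.facetList T l := by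
  refine Iff.trans ?_ (nodup_and_mem_iff_exists_map (face_insert_injOn (S := S) hT))
  refine and_congr_right fun _ => forall_congr' fun F => iff_congr Iff.rfl ?_
  simp only [S.isFacet_face_iff hT, Set.mem_image, Set.mem_ofPred_eq, eq_comm]

theorem face_insert_inter_prefixUnion (hl : l.Nodup) {j : ℕ} (hj : j < l.length) :
    S.face (insert l[j] T) ∩ prefixUnion (S.facetList T l) j =
      ⋃ k ∈ {k ∈ prefixSet l j | k.1 ≠ l[j].1}, S.face (insert k (insert l[j] T)) := by
  have hinter (k : FacetLabel ι) : S.face (insert l[j] T) ∩ S.face (insert k T) =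
      S.face (insert k (insert l[j] T)) := by
    rw [slackFace_inter]
    congr 1
    ext
    simp only [Set.mem_union, Set.mem_insert_iff]
    tauto
  rw [prefixUnion_facetList, Set.inter_iUnion₂]
  refine Set.Subset.antisymm (Set.iUnion₂_subset fun k hk x hx => ?_)
    (Set.iUnion₂_subset fun k hk => ?_)
  · rw [hinter] at hx
    refine Set.mem_biUnion (x := k) ⟨hk, fun hdir => ?_⟩ hx
    rcases eq_or_eq_opp hdir with rfl | rfl
    · exact getElem_notMem_prefixSet hl hj hk
    · exact S.face_nonempty_iff.1 ⟨x, hx⟩ l[j] (by simp) (by simp)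
  · exact (hinter k).ge.trans (Set.subset_biUnion_of_mem
      (u := fun k => S.face (insert l[j] T) ∩ S.face (insert k T)) hk.1)

theorem face_insert_inter_prefixUnion_nonempty_iff (hT : Consistent T)
    (hl : Enumerates (freeDirs T) l) {j : ℕ} (hj : j < l.length) :
    (S.face (insert l[j] T) ∩ prefixUnion (S.facetList T l) j).Nonempty ↔
      {k ∈ prefixSet l j | k.1 ≠ l[j].1}.Nonempty := by
  classical
  rw [face_insert_inter_prefixUnion hl.1 hj, Set.nonempty_biUnion]
  refine exists_congr fun k => and_iff_left_of_imp fun hk => S.face_nonempty ?_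
  refine (hT.insert ((hl.2 _).1 (List.getElem_mem hj))).insert ?_
  rw [freeDirs_insert]
  exact Finset.mem_erase.2 ⟨hk.2, (hl.2 k).1 (prefixSet_subset l j hk.1)⟩

theorem shellingStep_freeDirs_iff [DecidableEq ι] (hT : Consistent T)
    (hl : Enumerates (freeDirs T) l) {j : ℕ} (hj : j < l.length) :
    ShellingStep (freeDirs T) l[j].1 (prefixSet l j) ↔
      ∃ g, Enumerates (freeDirs (insert l[j] T)) g ∧ Indecomposable g ∧ ∃ r ≤ g.length,
        S.face (insert l[j] T) ∩ prefixUnion (S.facetList T l) j =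
          prefixUnion (S.facetList (insert l[j] T) g) r := by
  have hTj := hT.insert ((hl.2 _).1 (List.getElem_mem hj))
  rw [ShellingStep, face_insert_inter_prefixUnion hl.1 hj, ← freeDirs_insert]
  refine exists_congr fun g => and_congr_right fun hg => and_congr_right fun _ =>
    exists_congr fun r => and_congr_right fun _ => ?_
  rw [prefixUnion_facetList, (biUnion_face_insert_injOn hTj).eq_iff, eq_comm]
  · intro k hk
    rw [freeDirs_insert]
    exact Finset.mem_erase.2 ⟨hk.2, (hl.2 k).1 (prefixSet_subset l j hk.1)⟩
  · exact fun k hk => (hg.2 k).1 (prefixSet_subset g r hk)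

theorem inter_prefixUnion_facetList_iff_shellingStep [DecidableEq ι] {d : ℕ} (hT : Consistent T)
    (hl : Enumerates (freeDirs T) l) {j : ℕ} (hj : j < l.length)
    (hfacet : ∀ G, IsShellingOfDim d (S.face (insert l[j] T)) G ↔
      ∃ g, Enumerates (freeDirs (insert l[j] T)) g ∧ Indecomposable g ∧
        G = S.facetList (insert l[j] T) g) :
    ((0 < j → (S.face (insert l[j] T) ∩ prefixUnion (S.facetList T l) j).Nonempty) ∧
      ∃ G, IsShellingOfDim d (S.face (insert l[j] T)) G ∧ ∃ r ≤ G.length,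
        S.face (insert l[j] T) ∩ prefixUnion (S.facetList T l) j = prefixUnion G r) ↔
    (0 < j → {k ∈ prefixSet l j | k.1 ≠ l[j].1}.Nonempty) ∧
      ShellingStep (freeDirs T) l[j].1 (prefixSet l j) := by
  rw [face_insert_inter_prefixUnion_nonempty_iff hT hl hj,
    shellingStep_freeDirs_iff (S := S) hT hl hj]
  simp only [hfacet]
  refine and_congr_right fun _ => ⟨?_, ?_⟩
  · rintro ⟨_, ⟨g, hg, hgi, rfl⟩, r, hr, h⟩
    exact ⟨g, hg, hgi, r, by rwa [length_facetList] at hr, h⟩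
  · rintro ⟨g, hg, hgi, r, hr, h⟩
    exact ⟨_, ⟨g, hg, hgi, rfl⟩, r, by rwa [length_facetList], h⟩

theorem isShellingOfDim_face_iff (d : ℕ) (hT : Consistent T) (hcard : (freeDirs T).card = d + 1)
    {L : List (Set E)} :
    IsShellingOfDim (d + 1) (S.face T) L ↔
      ∃ l, Enumerates (freeDirs T) l ∧ Indecomposable l ∧ L = S.facetList T l := by
  classical
  induction d generalizing T L with
  | zero =>
    rw [IsShellingOfDim, isFacetOrdering_face_iff hT]
    exact exists_congr fun l => and_congr_right fun hl =>
      (and_iff_right (hl.indecomposable_of_card_eq_one hcard)).symm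
  | succ d ih =>
    have hstep {l} (hl : Enumerates (freeDirs T) l) {j : ℕ} (hj : j < l.length) :=
      have hdir := (hl.2 _).1 (List.getElem_mem hj)
      inter_prefixUnion_facetList_iff_shellingStep (S := S) (d := d + 1) hT hl hj fun _ =>
        ih (hT.insert hdir) (by rw [freeDirs_insert, Finset.card_erase_of_mem hdir, hcard]; rfl)
    rw [IsShellingOfDim, isFacetOrdering_face_iff hT]
    constructor
    · rintro ⟨⟨l, hl, rfl⟩, h⟩
      refine ⟨l, hl, (indecomposable_iff_shellingStep (by omega) hl).2 fun j hj => ?_, rfl⟩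
      have hj_facet := h j (by rwa [length_facetList])
      rw [getElem_facetList] at hj_facet
      exact (hstep hl hj).1 hj_facet
    · rintro ⟨l, hl, hind, rfl⟩
      refine ⟨⟨l, hl, rfl⟩, fun j hj => ?_⟩
      rw [getElem_facetList]
      rw [length_facetList] at hj
      exact (hstep hl hj).2 ((indecomposable_iff_shellingStep (by omega) hl).1 hind j hj)

theorem isShelling_face_empty_iff [Nonempty ι] {L : List (Set E)} :
    IsShelling (S.face ∅) L ↔
      ∃ l, Enumerates Finset.univ l ∧ Indecomposable l ∧ L = l.map fun k => S.face {k} := by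
  obtain ⟨d, hd⟩ := Nat.exists_eq_add_one_of_ne_zero (Fintype.card_ne_zero (α := ι))
  have hcard : (freeDirs (∅ : Set (FacetLabel ι))).card = d + 1 := by
    rw [freeDirs_empty, Finset.card_univ, hd]
  rw [IsShelling, S.affDim_face consistent_empty, hcard,
    isShellingOfDim_face_iff d consistent_empty hcard, freeDirs_empty]
  simp only [facetList, insert_empty_eq]

end CubeSystem

/-- The functionals `xᵢ` and `1 - xᵢ`, which define the standard cube. -/
def stdCubeSystem (ι : Type*) [Fintype ι] : CubeSystem ι (ι → ℝ) where
  slack k :=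
    let coord : (ι → ℝ) →ᵃ[ℝ] ℝ := (LinearMap.proj k.1 : (ι → ℝ) →ₗ[ℝ] ℝ).toAffineMap
    if k.2 then AffineMap.const ℝ _ 1 - coord else coord
  vertex s i := if s i then 1 else 0
  slack_self s i := by cases h : s i <;> simp [h]
  slack_not_pos s i := by cases h : s i <;> simp [h]
  finrank_eq := Module.finrank_fintype_fun_eq_card ℝ

section StandardCube

variable {ι : Type*} [Fintype ι]

@[simp] theorem stdCubeSystem_slack_true (i : ι) (x : ι → ℝ) :
    (stdCubeSystem ι).slack (i, true) x = 1 - x i := rfl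

@[simp] theorem stdCubeSystem_slack_false (i : ι) (x : ι → ℝ) :
    (stdCubeSystem ι).slack (i, false) x = x i := rfl

theorem stdCubeSystem_face_empty (n : ℕ) : (stdCubeSystem (Fin n)).face ∅ = stdCube n := by
  ext x
  simp [slackFace, stdCube, and_comm]

end StandardCube

end ShellingsOfCubes

section CountingShellings

section Orderings

variable {α : Type*} {s : Finset α} {l : List α}

/-- The orderings of the members of `s`: the lists in which each of them occurs once. -/
noncomputable def orderings (s : Finset α) : Finset (List α) := by
  classical exact s.toList.permutations.toFinset

theorem mem_orderings : l ∈ orderings s ↔ l.Nodup ∧ ∀ a, a ∈ l ↔ a ∈ s := by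
  simp only [orderings, List.mem_toFinset, List.mem_permutations]
  refine ⟨fun h => ⟨h.nodup_iff.2 s.nodup_toList, fun a => by simp [h.mem_iff]⟩, ?_⟩
  rintro ⟨h, hmem⟩
  exact (List.perm_ext_iff_of_nodup h s.nodup_toList).2 fun a => by simp [hmem]

theorem card_orderings (s : Finset α) : (orderings s).card = s.card ! := by
  classical
  rw [orderings, List.toFinset_card_of_nodup (List.nodup_permutations _ s.nodup_toList),
    List.length_permutations, Finset.length_toList]

end Orderings

namespace FacetLabel

variable {ι : Type*}

section Enumerations

variable {U V : Finset ι} {l l₁ l₂ : List (FacetLabel ι)}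

theorem Enumerates.unique (hU : Enumerates U l) (hV : Enumerates V l) : U = V := by
  ext i
  rw [← hU.2 (i, true), hV.2 (i, true)]

theorem Enumerates.length_pos (hl : Enumerates U l) (hU : U.Nonempty) : 0 < l.length :=
  hl.length_eq ▸ Nat.mul_pos two_pos hU.card_pos

theorem Enumerates.oppClosed (hl : Enumerates U l) : OppClosed {k | k ∈ l} :=
  fun k hk => (hl.2 (opp k)).2 ((hl.2 k).1 hk)

theorem Enumerates.append [DecidableEq ι] (h₁ : Enumerates V l₁) (h₂ : Enumerates (U \ V) l₂)
    (hVU : V ⊆ U) : Enumerates U (l₁ ++ l₂) := by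
  refine ⟨List.nodup_append.2 ⟨h₁.1, h₂.1, ?_⟩, fun k => ?_⟩
  · rintro k hk k' hk' rfl
    exact (Finset.mem_sdiff.1 ((h₂.2 k).1 hk')).2 ((h₁.2 k).1 hk)
  · rw [List.mem_append, h₁.2, h₂.2, ← Finset.mem_union, Finset.union_sdiff_of_subset hVU]

theorem Enumerates.of_oppClosed_prefixSet [DecidableEq ι] (hl : Enumerates U l) {m : ℕ}
    (hm : OppClosed (prefixSet l m)) :
    ∃ V ⊆ U, Enumerates V (l.take m) ∧ Enumerates (U \ V) (l.drop m) := by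
  classical
  have htake (k : FacetLabel ι) :
      k ∈ l.take m ↔ k.1 ∈ U.filter fun i => (i, true) ∈ l.take m := by
    rw [Finset.mem_filter]
    constructor
    · intro hk
      refine ⟨(hl.2 k).1 (List.mem_of_mem_take hk), ?_⟩
      rcases eq_or_eq_opp (k := (k.1, true)) (l := k) rfl with h | h
      exacts [h ▸ hk, h ▸ hm k hk]
    · rintro ⟨-, hk⟩
      rcases eq_or_eq_opp (k := k) (l := (k.1, true)) rfl with h | h
      exacts [h ▸ hk, h ▸ hm _ hk]
  have hnodup := hl.1
  rw [← List.take_append_drop m l, List.nodup_append] at hnodup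
  refine ⟨_, Finset.filter_subset _ _, ⟨hnodup.1, htake⟩, hnodup.2.1, fun k => ?_⟩
  rw [Finset.mem_sdiff, ← htake, ← hl.2 k]
  refine ⟨fun hk => ⟨List.mem_of_mem_drop hk, fun h => hnodup.2.2 k h k hk rfl⟩, ?_⟩
  rintro ⟨hkl, hktake⟩
  rw [← List.take_append_drop m l, List.mem_append] at hkl
  exact hkl.resolve_left hktake

theorem Enumerates.exists_append_indecomposable [DecidableEq ι] (hl : Enumerates U l)
    (hU : U.Nonempty) :
    ∃ V ⊆ U, V.Nonempty ∧ ∃ l₁ l₂, Enumerates V l₁ ∧ Indecomposable l₁ ∧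
      Enumerates (U \ V) l₂ ∧ l₁ ++ l₂ = l := by
  classical
  have hpos := hl.length_pos hU
  have hex : ∃ m, 0 < m ∧ OppClosed (prefixSet l m) :=
    ⟨l.length, hpos, prefixSet_of_length_le le_rfl ▸ hl.oppClosed⟩
  obtain ⟨hm, hclosed⟩ := Nat.find_spec hex
  obtain ⟨V, hVU, h₁, h₂⟩ := hl.of_oppClosed_prefixSet hclosed
  refine ⟨V, hVU, ?_, _, _, h₁, fun m hm0 hmlen hmclosed => ?_, h₂, List.take_append_drop _ l⟩
  · refine ⟨l[0].1, (h₁.2 _).1 ?_⟩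
    exact List.mem_take_iff_getElem.2 ⟨0, lt_min hm hpos, rfl⟩
  · rw [List.length_take, lt_min_iff] at hmlen
    refine Nat.find_min hex hmlen.1 ⟨hm0, ?_⟩
    rwa [prefixSet, List.take_take, min_eq_left hmlen.1.le] at hmclosed

theorem Indecomposable.length_le_of_append_eq {l₁' l₂' : List (FacetLabel ι)} (hU : U.Nonempty)
    (h : Enumerates U l₁) (hind : Indecomposable l₁') (heq : l₁ ++ l₂ = l₁' ++ l₂') :
    l₁'.length ≤ l₁.length := by
  by_contra! hlt
  have hinit : prefixSet l₁' l₁.length = {k | k ∈ l₁} := by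
    rw [prefixSet, ← List.take_append_of_le_length (l₂ := l₂') hlt.le, ← heq, List.take_left]
  exact hind _ (h.length_pos hU) hlt (hinit ▸ h.oppClosed)

end Enumerations

/-- The enumerations of the facet labels with directions in `U`. -/
noncomputable def enumerations (U : Finset ι) : Finset (List (FacetLabel ι)) :=
  orderings (U ×ˢ Finset.univ)

theorem mem_enumerations {U : Finset ι} {l : List (FacetLabel ι)} :
    l ∈ enumerations U ↔ Enumerates U l := by
  simp [enumerations, mem_orderings, Enumerates]

theorem card_enumerations (U : Finset ι) : (enumerations U).card = (2 * U.card)! := by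
  rw [enumerations, card_orderings, Finset.card_product, mul_comm]
  rfl

/-- The indecomposable enumerations of the facet labels with directions in `U`. -/
noncomputable def indecomposables (U : Finset ι) : Finset (List (FacetLabel ι)) := by
  classical exact (enumerations U).filter Indecomposable

theorem mem_indecomposables {U : Finset ι} {l : List (FacetLabel ι)} :
    l ∈ indecomposables U ↔ Enumerates U l ∧ Indecomposable l := by
  simp [indecomposables, mem_enumerations]

theorem card_enumerations_eq_sum [DecidableEq ι] {U : Finset ι} (hU : U.Nonempty) :
    (enumerations U).card =
      ∑ V ∈ U.powerset.erase ∅, (indecomposables V).card * (enumerations (U \ V)).card := by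
  simp_rw [← Finset.card_product]
  rw [← Finset.card_sigma]
  symm
  have hmem {V : Finset ι} {l₁ l₂ : List (FacetLabel ι)} :
      ⟨V, l₁, l₂⟩ ∈ (U.powerset.erase ∅).sigma
          (fun V => indecomposables V ×ˢ enumerations (U \ V)) ↔
        (V.Nonempty ∧ V ⊆ U) ∧ (Enumerates V l₁ ∧ Indecomposable l₁) ∧ Enumerates (U \ V) l₂ := by
    simp [mem_indecomposables, mem_enumerations, Finset.nonempty_iff_ne_empty]
  refine Finset.card_nbij (fun p => p.2.1 ++ p.2.2) ?_ ?_ ?_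
  · rintro ⟨V, l₁, l₂⟩ hp
    obtain ⟨⟨-, hVU⟩, ⟨h₁, -⟩, h₂⟩ := hmem.1 hp
    exact mem_enumerations.2 (h₁.append h₂ hVU)
  · rintro ⟨V, l₁, l₂⟩ hp ⟨V', l₁', l₂'⟩ hp' heq
    obtain ⟨⟨hV, -⟩, ⟨h₁, hind⟩, -⟩ := hmem.1 hp
    obtain ⟨⟨hV', -⟩, ⟨h₁', hind'⟩, -⟩ := hmem.1 hp'
    obtain ⟨rfl, rfl⟩ := List.append_inj heq <|
      (hind.length_le_of_append_eq hV' h₁' heq.symm).antisymm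
        (hind'.length_le_of_append_eq hV h₁ heq)
    obtain rfl := h₁.unique h₁'
    rfl
  · intro l hl
    obtain ⟨V, hVU, hV, l₁, l₂, h₁, hind, h₂, rfl⟩ :=
      (mem_enumerations.1 hl).exists_append_indecomposable hU
    exact ⟨⟨V, l₁, l₂⟩, hmem.2 ⟨⟨hV, hVU⟩, ⟨h₁, hind⟩, h₂⟩, rfl⟩

theorem card_indecomposables_eq_of_recurrence {f : ℕ → ℚ} (hzero : f 0 = 0)
    (hf : ∀ m, 0 < m →
      ∑ k ∈ Finset.range (m + 1), (m.choose k : ℚ) * (f k * ((2 * (m - k))! : ℚ)) = ((2 * m)! : ℚ))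
    {U : Finset ι} (hU : U.Nonempty) : ((indecomposables U).card : ℚ) = f U.card := by
  classical
  induction U using Finset.strongInduction with
  | H U ih =>
  have hU_mem : U ∈ U.powerset.erase ∅ := by simp [hU.ne_empty]
  have hsum_f : ∑ V ∈ U.powerset.erase ∅, f V.card * ((2 * (U.card - V.card))! : ℚ) =
      ((2 * U.card)! : ℚ) := by
    rw [Finset.sum_erase _ (by simp [hzero]), Finset.sum_powerset_apply_card
      (fun k => f k * ((2 * (U.card - k))! : ℚ)), ← hf U.card hU.card_pos]
    simp only [nsmul_eq_mul]
  have hsum_card : ∑ V ∈ U.powerset.erase ∅,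
      ((indecomposables V).card : ℚ) * ((2 * (U.card - V.card))! : ℚ) = ((2 * U.card)! : ℚ) := by
    rw [← card_enumerations, card_enumerations_eq_sum hU, Nat.cast_sum]
    refine Finset.sum_congr rfl fun V hV => ?_
    rw [card_enumerations, Finset.card_sdiff_of_subset
      (Finset.mem_powerset.1 (Finset.mem_of_mem_erase hV)), Nat.cast_mul]
  have hproper : ∀ V ∈ (U.powerset.erase ∅).erase U,
      ((indecomposables V).card : ℚ) * ((2 * (U.card - V.card))! : ℚ) =
        f V.card * ((2 * (U.card - V.card))! : ℚ) := fun V hV => by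
    simp only [Finset.mem_erase, Finset.mem_powerset] at hV
    rw [ih V (hV.2.2.ssubset_of_ne hV.1) (Finset.nonempty_iff_ne_empty.2 hV.2.1)]
  rw [← hsum_f, ← Finset.add_sum_erase _ _ hU_mem, ← Finset.add_sum_erase _ _ hU_mem,
    Finset.sum_congr rfl hproper] at hsum_card
  simpa using hsum_card

end FacetLabel

theorem numCubeShellings_eq {n : ℕ} [NeZero n] :
    numCubeShellings n = (indecomposables (Finset.univ : Finset (Fin n))).card := by
  have himage : shellings (stdCube n) = List.map (fun k => (stdCubeSystem (Fin n)).face {k}) ''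
      (indecomposables (Finset.univ : Finset (Fin n))) := by
    ext L
    rw [shellings, Set.mem_ofPred_eq, ← stdCubeSystem_face_empty,
      CubeSystem.isShelling_face_empty_iff]
    simp only [Set.mem_image, Finset.mem_coe, mem_indecomposables, and_assoc, eq_comm]
  have hinj := List.map_injective_iff.2 (stdCubeSystem (Fin n)).face_singleton_injective
  rw [numCubeShellings, himage, Set.ncard_image_of_injective _ hinj, Set.ncard_coe_finset]

theorem sum_choose_mul_eq_of_mul_mk_eq {F : PowerSeries ℚ} {a : ℕ → ℚ}
    (h : F * PowerSeries.mk (fun n => a n / n !) = PowerSeries.mk (fun n => a n / n !) - 1)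
    {m : ℕ} (hm : 0 < m) :
    ∑ k ∈ Finset.range (m + 1),
      (m.choose k : ℚ) * ((k ! * PowerSeries.coeff k F) * a (m - k)) = a m := by
  have hfac (j : ℕ) : (j ! : ℚ) ≠ 0 := mod_cast j.factorial_ne_zero
  have hcoeff := congrArg (fun G => (m ! : ℚ) * PowerSeries.coeff m G) h
  rw [PowerSeries.coeff_mul, Finset.Nat.sum_antidiagonal_eq_sum_range_succ_mk, map_sub,
    PowerSeries.coeff_one, if_neg hm.ne', sub_zero, PowerSeries.coeff_mk,
    mul_div_cancel₀ _ (hfac m), Finset.mul_sum] at hcoeff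
  rw [← hcoeff]
  refine Finset.sum_congr rfl fun k hk => ?_
  rw [PowerSeries.coeff_mk,
    ← Nat.choose_mul_factorial_mul_factorial (Nat.lt_succ_iff.1 (Finset.mem_range.1 hk))]
  push_cast
  field_simp [hfac]

theorem mk_numCubeShellings :
    PowerSeries.mk (fun n : ℕ => if n = 0 then (0 : ℚ) else (numCubeShellings n : ℚ) / (n ! : ℚ)) =
      1 - (PowerSeries.mk (fun n : ℕ => ((2 * n)! : ℚ) / (n ! : ℚ)))⁻¹ := by
  set G : PowerSeries ℚ := PowerSeries.mk (fun n : ℕ => ((2 * n)! : ℚ) / (n ! : ℚ)) with hG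
  have hG0 : PowerSeries.constantCoeff G = 1 := by
    simp [hG, ← PowerSeries.coeff_zero_eq_constantCoeff_apply]
  have hmul : (1 - G⁻¹) * G = G - 1 := by
    rw [sub_mul, one_mul, PowerSeries.inv_mul_cancel _ (by simp [hG0])]
  have hzero : PowerSeries.coeff 0 (1 - G⁻¹) = 0 := by simp [hG0]
  ext n
  rw [PowerSeries.coeff_mk]
  split_ifs with hn
  · rw [hn, hzero]
  · have : NeZero n := ⟨hn⟩
    rw [numCubeShellings_eq, card_indecomposables_eq_of_recurrence
      (f := fun k => k ! * PowerSeries.coeff k (1 - G⁻¹)) (by simp [hzero])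
      (fun m hm => sum_choose_mul_eq_of_mul_mk_eq (a := fun n => ((2 * n)! : ℚ)) hmul hm)
      Finset.univ_nonempty, Finset.card_univ, Fintype.card_fin]
    exact mul_div_cancel_left₀ _ (mod_cast n.factorial_ne_zero)

end CountingShellings

section LineShellings

namespace CubeSystem

variable {ι E : Type*} [Fintype ι] [NormedAddCommGroup E] [NormedSpace ℝ E] (S : CubeSystem ι E)

/-- The parameter at which the line `t ↦ p + t • v` meets the facet hyperplane labelled `k`
(and `0` if the line is parallel to it). -/
noncomputable def crossing (p v : E) (k : FacetLabel ι) : ℝ := -S.slack k p / (S.slack k).linear v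

variable {S} {p v : E} {k : FacetLabel ι}

theorem slack_add_smul_eq_zero_iff {t : ℝ} (hv : (S.slack k).linear v ≠ 0) :
    S.slack k (p + t • v) = 0 ↔ t = S.crossing p v k := by
  rw [crossing, eq_div_iff hv, eq_neg_iff_add_eq_zero, add_comm p, ← vadd_eq_add,
    AffineMap.map_vadd, map_smul, smul_eq_mul, vadd_eq_add]

theorem linear_ne_zero_of_slack_add_smul_eq_zero_iff {r : ℝ}
    (h : ∀ t : ℝ, S.slack k (p + t • v) = 0 ↔ t = r) : (S.slack k).linear v ≠ 0 := by
  intro hv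
  have hconst (t : ℝ) : S.slack k (p + t • v) = S.slack k p := by
    rw [add_comm p, ← vadd_eq_add, AffineMap.map_vadd, map_smul, hv, smul_zero, zero_vadd]
  have hr := (h r).2 rfl
  rw [hconst, ← hconst (r + 1), h] at hr
  exact add_ne_left.2 one_ne_zero hr

theorem isLineShellingAlong_iff [FiniteDimensional ℝ E] {L : List (Set E)} :
    IsLineShellingAlong (S.face ∅) p v L ↔ p ∈ interior (S.face ∅) ∧
      ∃ l, Enumerates Finset.univ l ∧ (∀ k, (S.slack k).linear v ≠ 0) ∧
        (l.Pairwise fun k k' => MetBefore (S.crossing p v k) (S.crossing p v k')) ∧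
        L = l.map fun k => S.face {k} := by
  rw [IsLineShellingAlong, isFacetOrdering_face_iff consistent_empty, freeDirs_empty]
  simp only [facetList, insert_empty_eq]
  refine and_congr_right fun _ => ⟨?_, ?_⟩
  · rintro ⟨⟨l, hl, rfl⟩, τ, hτ, hpair⟩
    have hzero (k) (t : ℝ) : S.slack k (p + t • v) = 0 ↔ t = τ (S.face {k}) := by
      rw [← S.mem_affineSpan_face_singleton_iff]
      exact hτ _ (List.mem_map.2 ⟨k, (hl.2 k).2 (Finset.mem_univ _), rfl⟩) t
    have hv (k) := linear_ne_zero_of_slack_add_smul_eq_zero_iff (hzero k)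
    have hcrossing (k) : τ (S.face {k}) = S.crossing p v k :=
      (slack_add_smul_eq_zero_iff (hv k)).1 ((hzero k _).2 rfl)
    rw [List.pairwise_map] at hpair
    simp only [hcrossing] at hpair
    exact ⟨l, hl, hv, hpair, rfl⟩
  · rintro ⟨l, hl, hv, hpair, rfl⟩
    refine ⟨⟨l, hl, rfl⟩, Function.extend (fun k => S.face {k}) (S.crossing p v) 0, ?_, ?_⟩
    · intro F hF t
      obtain ⟨k, -, rfl⟩ := List.mem_map.1 hF
      rw [S.face_singleton_injective.extend_apply, S.mem_affineSpan_face_singleton_iff,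
        slack_add_smul_eq_zero_iff (hv k)]
    · rw [List.pairwise_map]
      simpa only [S.face_singleton_injective.extend_apply] using hpair

end CubeSystem

namespace MetBefore

variable {s t : ℝ}

theorem pos (h : MetBefore s t) (ht : 0 < t) : 0 < s :=
  h.elim And.left fun h => pos_of_mul_pos_left h.1 ht.le

theorem lt_of_pos (h : MetBefore s t) (ht : 0 < t) : s < t :=
  h.elim (fun h => absurd h.2 ht.not_gt) And.right

theorem lt_of_neg (h : MetBefore s t) (hs : s < 0) : s < t :=
  h.elim (fun h => absurd h.1 hs.not_gt) And.right

end MetBefore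

theorem eq_filter_append_filter_of_pairwise {α : Type*} {q : α → Prop} [DecidablePred q]
    {l : List α} (hl : l.Pairwise fun a b => q b → q a) :
    l = l.filter q ++ l.filter fun a => ¬q a := by
  induction l with
  | nil => rfl
  | cons a l ih =>
    rw [List.pairwise_cons] at hl
    by_cases ha : q a
    · simpa [ha] using ih hl.2
    · have hnot : ∀ b ∈ l, ¬q b := fun b hb hq => ha (hl.1 b hb hq)
      have hfilter : l.filter q = [] :=
        List.filter_eq_nil_iff.2 fun b hb => by simpa using hnot b hb
      have hfilter_not : (l.filter fun a => ¬q a) = l :=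
        List.filter_eq_self.2 fun b hb => by simpa using hnot b hb
      simp only [List.filter_cons, ha, not_false_eq_true, hfilter, hfilter_not, decide_false,
        decide_true, Bool.false_eq_true, if_true, if_false, List.nil_append]

section SignedLists

variable {ι : Type*}

/-- The facet labels with signs `s`, in directions ordered by `l₁`, followed by the opposite ones,
in directions ordered by `l₂`. -/
def signedList (s : ι → Bool) (l₁ l₂ : List ι) : List (FacetLabel ι) :=
  (l₁.map fun i => (i, s i)) ++ l₂.map fun i => (i, !s i)

theorem pairwise_signedList_iff {R : FacetLabel ι → FacetLabel ι → Prop} {s : ι → Bool}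
    {l₁ l₂ : List ι} : (signedList s l₁ l₂).Pairwise R ↔
      (l₁.Pairwise fun i j => R (i, s i) (j, s j)) ∧
      (l₂.Pairwise fun i j => R (i, !s i) (j, !s j)) ∧
        ∀ i ∈ l₁, ∀ j ∈ l₂, R (i, s i) (j, !s j) := by
  simp only [signedList, List.pairwise_append, List.pairwise_map, List.forall_mem_map]

theorem pairwise_idxOf [BEq ι] [LawfulBEq ι] {l : List ι} (h : l.Nodup) :
    l.Pairwise fun i j => (l.idxOf i : ℝ) < l.idxOf j := by
  rw [List.pairwise_iff_getElem]
  intro i j hi hj hij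
  rw [h.idxOf_getElem, h.idxOf_getElem]
  exact_mod_cast hij

variable [Fintype ι]

theorem mem_orderings_univ {l : List ι} : l ∈ orderings Finset.univ ↔ l.Nodup ∧ ∀ i, i ∈ l := by
  simp [mem_orderings]

theorem perm_of_mem_orderings_univ {l l' : List ι} (h : l ∈ orderings Finset.univ)
    (h' : l' ∈ orderings Finset.univ) : l.Perm l' := by
  rw [mem_orderings] at h h'
  exact (List.perm_ext_iff_of_nodup h.1 h'.1).2 fun i => by rw [h.2, h'.2]

theorem reverse_mem_orderings_univ {l : List ι} (h : l ∈ orderings Finset.univ) :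
    l.reverse ∈ orderings Finset.univ := by
  simpa [mem_orderings_univ] using h

theorem signedList_injOn : Set.InjOn
    (fun x : (ι → Bool) × List ι × List ι => signedList x.1 x.2.1 x.2.2)
    {x | x.2.1 ∈ orderings Finset.univ} := by
  rintro ⟨s, l₁, l₂⟩ h ⟨s', l₁', l₂'⟩ h' heq
  simp only [Set.mem_ofPred_eq] at h h'
  obtain ⟨heq₁, heq₂⟩ := List.append_inj heq
    (by simpa using (perm_of_mem_orderings_univ h h').length_eq)
  have hl₁ := congrArg (List.map Prod.fst) heq₁
  have hl₂ := congrArg (List.map Prod.fst) heq₂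
  simp only [List.map_map, Function.comp_def, List.map_id'] at hl₁ hl₂
  subst hl₁ hl₂
  obtain rfl : s = s' := funext fun i =>
    congrArg Prod.snd (List.map_inj_left.1 heq₁ i ((mem_orderings_univ.1 h).2 i))
  rfl

theorem enumerates_signedList (s : ι → Bool) {l₁ l₂ : List ι} (h₁ : l₁ ∈ orderings Finset.univ)
    (h₂ : l₂ ∈ orderings Finset.univ) : Enumerates Finset.univ (signedList s l₁ l₂) := by
  rw [mem_orderings_univ] at h₁ h₂
  refine ⟨?_, fun k => ?_⟩
  · refine pairwise_signedList_iff.2 ⟨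
      (List.nodup_iff_pairwise_ne.1 h₁.1).imp fun h => mt (congrArg Prod.fst) h,
      (List.nodup_iff_pairwise_ne.1 h₂.1).imp fun h => mt (congrArg Prod.fst) h,
      fun i _ j _ h => ?_⟩
    obtain ⟨rfl, h⟩ := Prod.mk.inj h
    exact Bool.not_ne_self _ h.symm
  · obtain ⟨i, b⟩ := k
    rcases Bool.eq_or_eq_not b (s i) with rfl | rfl <;> simp [signedList, h₁.2, h₂.2]

theorem exists_mem_orderings_map_eq {s : ι → Bool} {m : List (FacetLabel ι)} (hm : m.Nodup)
    (hmem : ∀ k, k ∈ m ↔ s k.1 = k.2) :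
    ∃ l ∈ orderings Finset.univ, m = l.map fun i => (i, s i) := by
  have hinj : Set.InjOn (fun i => (i, s i)) Set.univ := fun i _ j _ h => congrArg Prod.fst h
  obtain ⟨l, hl, rfl⟩ := (nodup_and_mem_iff_exists_map (L := m) hinj).1
    ⟨hm, fun k => (hmem k).trans (by simp [Prod.ext_iff])⟩
  exact ⟨l, mem_orderings_univ.2 ⟨hl.1, fun i => (hl.2 i).2 trivial⟩, rfl⟩

theorem exists_eq_signedList {s : ι → Bool} {l : List (FacetLabel ι)}
    (hl : Enumerates Finset.univ l) (hpair : l.Pairwise fun k k' => s k'.1 = k'.2 → s k.1 = k.2) :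
    ∃ l₁ ∈ orderings Finset.univ, ∃ l₂ ∈ orderings Finset.univ, l = signedList s l₁ l₂ := by
  have hnot (k : FacetLabel ι) : (!s k.1) = k.2 ↔ ¬s k.1 = k.2 := by
    cases s k.1 <;> cases k.2 <;> simp
  obtain ⟨l₁, h₁, heq₁⟩ := exists_mem_orderings_map_eq (s := s)
    (hl.1.filter fun k => s k.1 = k.2) fun k => by simp [hl.2]
  obtain ⟨l₂, h₂, heq₂⟩ := exists_mem_orderings_map_eq (s := fun i => !s i)
    (hl.1.filter fun k => ¬s k.1 = k.2) fun k => by simp [hl.2, hnot]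
  refine ⟨l₁, h₁, l₂, h₂, ?_⟩
  rw [signedList, ← heq₁, ← heq₂]
  exact eq_filter_append_filter_of_pairwise hpair

end SignedLists

section StandardCube

variable {ι : Type*} [Fintype ι] {p v : ι → ℝ}

theorem mem_interior_stdCubeSystem_face_empty :
    p ∈ interior ((stdCubeSystem ι).face ∅) ↔ ∀ i, 0 < p i ∧ p i < 1 := by
  have hpi : (stdCubeSystem ι).face ∅ = Set.pi Set.univ fun _ => Set.Icc (0 : ℝ) 1 := by
    ext x
    simp [slackFace, and_comm, -Set.pi_univ_Icc]
  rw [hpi, interior_pi_set Set.finite_univ]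
  simp [Set.mem_pi]

theorem stdCubeSystem_slack_linear_true (i : ι) :
    ((stdCubeSystem ι).slack (i, true)).linear v = -v i := by simp [stdCubeSystem]

theorem stdCubeSystem_slack_linear_false (i : ι) :
    ((stdCubeSystem ι).slack (i, false)).linear v = v i := by simp [stdCubeSystem]

theorem stdCubeSystem_crossing_true (i : ι) :
    (stdCubeSystem ι).crossing p v (i, true) = (1 - p i) / v i := by
  rw [CubeSystem.crossing, stdCubeSystem_slack_true, stdCubeSystem_slack_linear_true,
    neg_div_neg_eq]

theorem stdCubeSystem_crossing_false (i : ι) :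
    (stdCubeSystem ι).crossing p v (i, false) = -p i / v i := by
  rw [CubeSystem.crossing, stdCubeSystem_slack_false, stdCubeSystem_slack_linear_false]

theorem isLineShellingAlong_stdCubeSystem_iff {L : List (Set (ι → ℝ))} :
    IsLineShellingAlong ((stdCubeSystem ι).face ∅) p v L ↔ (∀ i, 0 < p i ∧ p i < 1) ∧
      ∃ l, Enumerates Finset.univ l ∧ (∀ i, v i ≠ 0) ∧
        (l.Pairwise fun k k' =>
          MetBefore ((stdCubeSystem ι).crossing p v k) ((stdCubeSystem ι).crossing p v k')) ∧
        L = l.map fun k => (stdCubeSystem ι).face {k} := by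
  rw [CubeSystem.isLineShellingAlong_iff, mem_interior_stdCubeSystem_face_empty]
  simp only [Prod.forall, Bool.forall_bool, stdCubeSystem_slack_linear_false,
    stdCubeSystem_slack_linear_true, ne_eq, neg_eq_zero, and_self]

theorem exists_crossing_pos_and_crossing_not_neg (hp : ∀ i, 0 < p i ∧ p i < 1)
    (hv : ∀ i, v i ≠ 0) : ∃ s : ι → Bool, ∀ i, 0 < (stdCubeSystem ι).crossing p v (i, s i) ∧
      (stdCubeSystem ι).crossing p v (i, !s i) < 0 := by
  suffices h : ∀ i, ∃ b, 0 < (stdCubeSystem ι).crossing p v (i, b) ∧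
      (stdCubeSystem ι).crossing p v (i, !b) < 0 from Classical.skolem.1 h
  intro i
  obtain ⟨hpos, hlt⟩ := hp i
  rcases lt_or_gt_of_ne (hv i) with hneg | hpos'
  · refine ⟨false, ?_, ?_⟩
    · rw [stdCubeSystem_crossing_false]
      exact div_pos_of_neg_of_neg (neg_lt_zero.2 hpos) hneg
    · rw [Bool.not_false, stdCubeSystem_crossing_true]
      exact div_neg_of_pos_of_neg (sub_pos.2 hlt) hneg
  · refine ⟨true, ?_, ?_⟩
    · rw [stdCubeSystem_crossing_true]
      exact div_pos (sub_pos.2 hlt) hpos'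
    · rw [Bool.not_true, stdCubeSystem_crossing_false]
      exact div_neg_of_neg_of_pos (neg_lt_zero.2 hpos) hpos'

theorem exists_signedList_of_isLineShellingAlong {L : List (Set (ι → ℝ))}
    (h : IsLineShellingAlong ((stdCubeSystem ι).face ∅) p v L) :
    ∃ s, ∃ l₁ ∈ orderings Finset.univ, ∃ l₂ ∈ orderings Finset.univ,
      (l₁.Pairwise fun i j =>
        (stdCubeSystem ι).crossing p v (i, s i) < (stdCubeSystem ι).crossing p v (j, s j)) ∧
      (l₂.Pairwise fun i j =>
        (stdCubeSystem ι).crossing p v (i, !s i) < (stdCubeSystem ι).crossing p v (j, !s j)) ∧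
      L = (signedList s l₁ l₂).map fun k => (stdCubeSystem ι).face {k} := by
  obtain ⟨hp, l, hl, hv, hpair, rfl⟩ := isLineShellingAlong_stdCubeSystem_iff.1 h
  obtain ⟨s, hs⟩ := exists_crossing_pos_and_crossing_not_neg hp hv
  have hpositive_first {k k' : FacetLabel ι}
      (h : MetBefore ((stdCubeSystem ι).crossing p v k) ((stdCubeSystem ι).crossing p v k'))
      (hk' : s k'.1 = k'.2) : s k.1 = k.2 := by
    obtain ⟨i, b⟩ := k
    obtain ⟨j, b'⟩ := k'
    obtain rfl : s j = b' := hk'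
    rcases Bool.eq_or_eq_not b (s i) with rfl | rfl
    · rfl
    · exact absurd (h.pos (hs j).1) (hs i).2.not_gt
  obtain ⟨l₁, h₁, l₂, h₂, rfl⟩ := exists_eq_signedList hl (hpair.imp hpositive_first)
  obtain ⟨hpair₁, hpair₂, -⟩ := pairwise_signedList_iff.1 hpair
  exact ⟨s, l₁, h₁, l₂, h₂, hpair₁.imp fun h => h.lt_of_pos (hs _).1,
    hpair₂.imp fun h => h.lt_of_neg (hs _).2, rfl⟩

theorem isLineShellingAlong_signedList (s : ι → Bool) {l₁ l₂ : List ι}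
    (h₁ : l₁ ∈ orderings Finset.univ) (h₂ : l₂ ∈ orderings Finset.univ) {a b : ι → ℝ}
    (ha : ∀ i, 0 < a i) (hb : ∀ i, 0 < b i) (hl₁ : l₁.Pairwise fun i j => a i < a j)
    (hl₂ : l₂.Pairwise fun i j => b j < b i) :
    IsLineShellingAlong ((stdCubeSystem ι).face ∅)
      (fun i => (if s i then b i else a i) / (a i + b i))
      (fun i => (if s i then 1 else -1) / (a i + b i))
      ((signedList s l₁ l₂).map fun k => (stdCubeSystem ι).face {k}) := by
  have hab (i) : 0 < a i + b i := add_pos (ha i) (hb i)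
  set p : ι → ℝ := fun i => (if s i then b i else a i) / (a i + b i) with hp
  set v : ι → ℝ := fun i => (if s i then 1 else -1) / (a i + b i) with hv
  have hcrossing (i) : (stdCubeSystem ι).crossing p v (i, s i) = a i := by
    have := (hab i).ne'
    cases h : s i
    · rw [stdCubeSystem_crossing_false]
      simp only [hp, hv, h, Bool.false_eq_true, if_false]
      field
    · rw [stdCubeSystem_crossing_true]
      simp only [hp, hv, h, if_true]
      field
  have hcrossing_not (i) : (stdCubeSystem ι).crossing p v (i, !s i) = -b i := by
    have := (hab i).ne'
    cases h : s i
    · rw [Bool.not_false, stdCubeSystem_crossing_true]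
      simp only [hp, hv, h, Bool.false_eq_true, if_false]
      field
    · rw [Bool.not_true, stdCubeSystem_crossing_false]
      simp only [hp, hv, h, if_true]
      field
  refine isLineShellingAlong_stdCubeSystem_iff.2 ⟨fun i => ?_, signedList s l₁ l₂,
    enumerates_signedList s h₁ h₂, fun i => ?_, pairwise_signedList_iff.2 ⟨?_, ?_, ?_⟩, rfl⟩
  · rw [hp, lt_div_iff₀ (hab i), div_lt_one (hab i)]
    split_ifs <;> constructor <;> linarith [ha i, hb i]
  · exact div_ne_zero (by split_ifs <;> norm_num) (hab i).ne'
  · simp only [hcrossing]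
    exact hl₁.imp fun h => Or.inr ⟨mul_pos (ha _) (ha _), h⟩
  · simp only [hcrossing_not]
    exact hl₂.imp fun h => Or.inr ⟨neg_mul_neg (b _) (b _) ▸ mul_pos (hb _) (hb _), neg_lt_neg h⟩
  · simp only [hcrossing, hcrossing_not]
    exact fun i _ j _ => Or.inl ⟨ha i, neg_lt_zero.2 (hb j)⟩

theorem lineShellings_stdCubeSystem : lineShellings ((stdCubeSystem ι).face ∅) =
    (fun x : (ι → Bool) × List ι × List ι =>
      (signedList x.1 x.2.1 x.2.2).map fun k => (stdCubeSystem ι).face {k}) ''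
      (Set.univ ×ˢ
        ↑(orderings (Finset.univ : Finset ι)) ×ˢ ↑(orderings (Finset.univ : Finset ι))) := by
  classical
  ext L
  constructor
  · rintro ⟨p, v, h⟩
    obtain ⟨s, l₁, h₁, l₂, h₂, -, -, rfl⟩ := exists_signedList_of_isLineShellingAlong h
    exact ⟨(s, l₁, l₂), ⟨trivial, h₁, h₂⟩, rfl⟩
  · rintro ⟨⟨s, l₁, l₂⟩, ⟨-, h₁, h₂⟩, rfl⟩
    refine ⟨_, _, isLineShellingAlong_signedList s h₁ h₂ (a := fun i => l₁.idxOf i + 1)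
      (b := fun i => l₂.length - l₂.idxOf i) (fun i => by positivity) (fun i => ?_) ?_ ?_⟩
    · exact sub_pos.2 <| Nat.cast_lt.2 <|
        List.idxOf_lt_length_of_mem ((mem_orderings_univ.1 h₂).2 i)
    · exact (pairwise_idxOf (mem_orderings.1 h₁).1).imp fun h => by linarith
    · exact (pairwise_idxOf (mem_orderings.1 h₂).1).imp fun h => by linarith

theorem map_face_signedList_injOn : Set.InjOn
    (fun x : (ι → Bool) × List ι × List ι =>
      (signedList x.1 x.2.1 x.2.2).map fun k => (stdCubeSystem ι).face {k})
    {x | x.2.1 ∈ orderings Finset.univ} :=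
  (List.map_injective_iff.2 (stdCubeSystem ι).face_singleton_injective).comp_injOn signedList_injOn

theorem ncard_lineShellings_stdCubeSystem :
    (lineShellings ((stdCubeSystem ι).face ∅)).ncard =
      2 ^ Fintype.card ι * (Fintype.card ι)! ^ 2 := by
  classical
  rw [lineShellings_stdCubeSystem, Set.InjOn.ncard_image fun _ hx _ hy =>
    map_face_signedList_injOn hx.2.1 hy.2.1]
  simp [Set.ncard_prod, Set.ncard_univ, card_orderings, sq]

/-- A line through the center meets opposite facets at opposite parameters, so it meets the last
facets in the reverse order of the first ones. -/
theorem lineShellingsThrough_stdCubeSystem_center :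
    lineShellingsThrough ((stdCubeSystem ι).face ∅) (fun _ => 1 / 2) =
    (fun x : (ι → Bool) × List ι =>
      (signedList x.1 x.2 x.2.reverse).map fun k => (stdCubeSystem ι).face {k}) ''
      (Set.univ ×ˢ ↑(orderings (Finset.univ : Finset ι))) := by
  classical
  ext L
  constructor
  · rintro ⟨v, h⟩
    obtain ⟨s, l₁, h₁, l₂, h₂, hl₁, hl₂, rfl⟩ := exists_signedList_of_isLineShellingAlong h
    have hopp (i) : (stdCubeSystem ι).crossing (fun _ => 1 / 2) v (i, !s i) =
        -(stdCubeSystem ι).crossing (fun _ => 1 / 2) v (i, s i) := by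
      cases s i <;>
        simp only [Bool.not_false, Bool.not_true, stdCubeSystem_crossing_true,
          stdCubeSystem_crossing_false] <;> ring
    simp only [hopp, neg_lt_neg_iff] at hl₂
    obtain rfl : l₁ = l₂.reverse :=
      List.Perm.eq_of_pairwise (fun _ _ _ _ h h' => absurd h (lt_asymm h')) hl₁
        (List.pairwise_reverse.2 hl₂)
        (perm_of_mem_orderings_univ h₁ (reverse_mem_orderings_univ h₂))
    exact ⟨(s, l₂.reverse), ⟨trivial, h₁⟩, by simp only [List.reverse_reverse]⟩
  · rintro ⟨⟨s, l⟩, ⟨-, h⟩, rfl⟩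
    have hlt : l.Pairwise fun i j => (l.idxOf i : ℝ) + 1 < l.idxOf j + 1 :=
      (pairwise_idxOf (mem_orderings.1 h).1).imp fun h => by linarith
    have hline := isLineShellingAlong_signedList s h (reverse_mem_orderings_univ h)
      (a := fun i => l.idxOf i + 1) (b := fun i => l.idxOf i + 1) (fun i => by positivity)
      (fun i => by positivity) hlt (List.pairwise_reverse.2 hlt)
    have hcenter (i) : (if s i then (l.idxOf i : ℝ) + 1 else (l.idxOf i : ℝ) + 1) /
        ((l.idxOf i : ℝ) + 1 + ((l.idxOf i : ℝ) + 1)) = 1 / 2 := by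
      rw [ite_self]
      field
    simp only [hcenter] at hline
    exact ⟨_, hline⟩

theorem ncard_lineShellingsThrough_stdCubeSystem_center :
    (lineShellingsThrough ((stdCubeSystem ι).face ∅) fun _ => 1 / 2).ncard =
      2 ^ Fintype.card ι * (Fintype.card ι)! := by
  classical
  rw [lineShellingsThrough_stdCubeSystem_center, Set.InjOn.ncard_image]
  · simp [Set.ncard_prod, Set.ncard_univ, card_orderings]
  · rintro ⟨s, l⟩ hx ⟨s', l'⟩ hy h
    have := map_face_signedList_injOn (x₁ := (s, l, l.reverse)) hx.2
      (x₂ := (s', l', l'.reverse)) hy.2 h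
    simp_all

end StandardCube

end LineShellings

section Realization

namespace FacetLabel

variable {ι : Type*} [Fintype ι] {l : List (FacetLabel ι)}

theorem Indecomposable.eq_empty_or_eq_univ_of_oppClosed (hl : Enumerates Finset.univ l)
    (hind : Indecomposable l) {A : Set (FacetLabel ι)} (hA : OppClosed A)
    (hinit : l.Pairwise fun k k' => k' ∈ A → k ∈ A) : A = ∅ ∨ A = Set.univ := by
  classical
  have hmem (k : FacetLabel ι) : k ∈ l := (hl.2 k).2 (Finset.mem_univ _)
  have htake : l.take (l.filter (· ∈ A)).length = l.filter (· ∈ A) := by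
    conv_lhs => rw [eq_filter_append_filter_of_pairwise hinit]
    simp
  have hinit : prefixSet l (l.filter (· ∈ A)).length = A := by
    ext k
    simp [prefixSet, htake, hmem]
  by_contra hproper
  rw [not_or] at hproper
  refine hind _ (Nat.pos_of_ne_zero fun h => hproper.1 ?_)
    (lt_of_not_ge fun h => hproper.2 ?_) (by rwa [hinit])
  · rw [← hinit, h, prefixSet_zero]
  · rw [← hinit, prefixSet_of_length_le h]
    exact Set.eq_univ_of_forall hmem

theorem Indecomposable.isPreconnected_iUnion_uIoo (hl : Enumerates Finset.univ l)
    (hind : Indecomposable l) {h : FacetLabel ι → ℝ} (hsort : l.Pairwise fun k k' => h k' < h k) :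
    IsPreconnected (⋃ i, Set.uIoo (h (i, true)) (h (i, false))) := by
  refine (Set.ordConnected_of_Ioo fun x hx y hy _ t ⟨hxt, hty⟩ => ?_).isPreconnected
  by_contra ht
  have hge {k : FacetLabel ι} (hk : t < max (h (k.1, true)) (h (k.1, false))) (b : Bool) :
      t ≤ h (k.1, b) := by
    simp only [Set.mem_iUnion, not_exists, Set.uIoo, Set.mem_Ioo, not_and', not_lt] at ht
    exact (le_inf_iff.1 (ht k.1 hk)).elim fun htrue hfalse => by cases b <;> assumption
  have hA : OppClosed {k : FacetLabel ι | t < max (h (k.1, true)) (h (k.1, false))} :=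
    fun _ hk => hk
  have hle_max (k : FacetLabel ι) : h k ≤ max (h (k.1, true)) (h (k.1, false)) := by
    obtain ⟨i, _ | _⟩ := k <;> simp
  obtain ⟨i, hxi⟩ := Set.mem_iUnion.1 hx
  obtain ⟨j, hyj⟩ := Set.mem_iUnion.1 hy
  rcases hind.eq_empty_or_eq_univ_of_oppClosed hl hA
    (hsort.imp fun hlt hk' => ((hge hk' _).trans_lt hlt).trans_le (hle_max _)) with hA | hA
  · exact (Set.eq_empty_iff_forall_notMem.1 hA (j, true)) (hty.trans hyj.2)
  · have hi : (i, true) ∈ {k : FacetLabel ι | t < max (h (k.1, true)) (h (k.1, false))} :=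
      hA ▸ Set.mem_univ _
    exact (hxi.1.trans hxt).not_ge (le_min (hge hi true) (hge hi false))

end FacetLabel

theorem sub_div_sub_lt_one_of_mem_uIoo {a b c d : ℝ} (hd : d ∈ Set.uIoo a b)
    (hc : c ∈ Set.uIcc a b) (hca : c ≠ a) : (c - d) / (a - d) < 1 := by
  rcases le_total a b with hab | hba
  · rw [Set.uIoo_of_le hab, Set.mem_Ioo] at hd
    rw [Set.uIcc_of_le hab, Set.mem_Icc] at hc
    rw [div_lt_one_of_neg (sub_neg.2 hd.1)]
    exact sub_lt_sub_right (lt_of_le_of_ne hc.1 hca.symm) d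
  · rw [Set.uIoo_of_ge hba, Set.mem_Ioo] at hd
    rw [Set.uIcc_of_ge hba, Set.mem_Icc] at hc
    rw [div_lt_one (sub_pos.2 hd.2)]
    exact sub_lt_sub_right (lt_of_le_of_ne hc.2 hca) d

section Tilt

variable {ι : Type*} [DecidableEq ι]

/-- The functional that agrees with `f` where the `i`-th coordinate vanishes, and vanishes at
`ξ + t • eᵢ`, for `ξ` with vanishing `i`-th coordinate. -/
noncomputable def tilt (f : (ι → ℝ) →ᵃ[ℝ] ℝ) (ξ : ι → ℝ) (i : ι) (t : ℝ) : (ι → ℝ) →ᵃ[ℝ] ℝ :=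
  f - ((f ξ / t + f.linear (Pi.single i 1)) •
    (LinearMap.proj i : (ι → ℝ) →ₗ[ℝ] ℝ)).toAffineMap

variable {f : (ι → ℝ) →ᵃ[ℝ] ℝ} {ξ x : ι → ℝ} {i : ι}

theorem tilt_of_apply_eq_zero {t : ℝ} (hx : x i = 0) : tilt f ξ i t x = f x := by
  simp [tilt, hx]

theorem tilt_add_smul_single {t r : ℝ} (hξ : ξ i = 0) :
    tilt f ξ i t (ξ + r • Pi.single i 1) = f ξ * (1 - r / t) := by
  have hf : f (ξ + r • Pi.single i 1) = f ξ + r * f.linear (Pi.single i 1) := by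
    rw [add_comm ξ, ← vadd_eq_add, AffineMap.map_vadd, map_smul, smul_eq_mul, vadd_eq_add, add_comm]
  simp only [tilt, AffineMap.coe_sub, Pi.sub_apply, hf, LinearMap.coe_toAffineMap,
    LinearMap.smul_apply, LinearMap.proj_apply, Pi.add_apply, hξ, Pi.smul_apply,
    Pi.single_eq_same, smul_eq_mul]
  ring

end Tilt

section Functionals

variable {ι : Type*} [Fintype ι]

/-- The height function `x ↦ c + ∑ i, x i`. -/
noncomputable def coordHeight (c : ℝ) : (ι → ℝ) →ᵃ[ℝ] ℝ :=
  AffineMap.const ℝ _ c + (Fintype.linearCombination ℝ fun _ => 1).toAffineMap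

theorem coordHeight_apply (c : ℝ) (x : ι → ℝ) : coordHeight c x = c + ∑ i, x i := by
  simp [coordHeight, Fintype.linearCombination_apply]

variable [DecidableEq ι]

theorem coordHeight_add_smul_single (c t : ℝ) (x : ι → ℝ) (i : ι) :
    coordHeight c (x + t • Pi.single i 1) = coordHeight c x + t := by
  simp [coordHeight_apply, Finset.sum_add_distrib, add_assoc, ← Finset.mul_sum]

/-- The functional defining the facet dual to the vertex `b`, for polarity with respect to `o`. -/
noncomputable def polarFunctional (o b : ι → ℝ) : (ι → ℝ) →ᵃ[ℝ] ℝ :=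
  AffineMap.const ℝ _ 1 - (Fintype.linearCombination ℝ (b - o)).toAffineMap

/-- The vertex dual to the facet defined by `f`, for polarity with respect to `o`. -/
noncomputable def polarPoint (o : ι → ℝ) (f : (ι → ℝ) →ᵃ[ℝ] ℝ) : ι → ℝ :=
  fun j => -f.linear (Pi.single j 1) / f o

theorem polarFunctional_polarPoint {o b : ι → ℝ} (hf : f o ≠ 0) :
    polarFunctional o b (polarPoint o f) = f b / f o := by
  have hsum : ∑ j, (b - o) j * f.linear (Pi.single j 1) = f b - f o := by
    rw [← vsub_eq_sub (f b), ← f.linearMap_vsub, vsub_eq_sub]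
    conv_rhs => rw [← Finset.univ_sum_single (b - o), map_sum]
    refine Finset.sum_congr rfl fun j _ => ?_
    rw [← smul_eq_mul, ← map_smul, ← Pi.single_smul, smul_eq_mul, mul_one]
  have hcomb : ∑ j, polarPoint o f j • (b - o) j = -(f b - f o) / f o := by
    rw [← hsum, ← Finset.sum_neg_distrib, Finset.sum_div]
    refine Finset.sum_congr rfl fun j _ => ?_
    rw [polarPoint, smul_eq_mul]
    ring
  calc polarFunctional o b (polarPoint o f) = 1 - ∑ j, polarPoint o f j • (b - o) j := rfl
    _ = f b / f o := by rw [hcomb]; field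

end Functionals

/-- A cross-polytope in the coordinate subspace of `U`, whose vertices have prescribed heights `h k`
with respect to `coordHeight c`. Dually to `CubeSystem`, there is one functional for each facet. -/
structure CrossPolytope {ι : Type*} [Fintype ι] (c : ℝ) (h : FacetLabel ι → ℝ) (U : Finset ι) where
  /-- The vertices; those with labels in directions outside of `U` are irrelevant. -/
  vertex : FacetLabel ι → ι → ℝ
  /-- The functional that vanishes on the facet with vertices `(i, s i)`. -/
  slack : (ι → Bool) → (ι → ℝ) →ᵃ[ℝ] ℝ
  coordHeight_vertex : ∀ k, k.1 ∈ U → coordHeight c (vertex k) = h k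
  vertex_apply_eq_zero : ∀ k, k.1 ∈ U → ∀ j ∉ U, vertex k j = 0
  slack_self : ∀ s, ∀ i ∈ U, slack s (vertex (i, s i)) = 0
  slack_not_pos : ∀ s, ∀ i ∈ U, 0 < slack s (vertex (i, !s i))

namespace CrossPolytope

variable {ι : Type*} [Fintype ι] {c : ℝ} {h : FacetLabel ι → ℝ} {U : Finset ι}

/-- The relative interior. -/
def inner (B : CrossPolytope c h U) : Set (ι → ℝ) :=
  {x | (∀ j ∉ U, x j = 0) ∧ ∀ s, 0 < B.slack s x}

/-- The cross-polytope of dimension zero at the origin. -/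
def point (c : ℝ) (h : FacetLabel ι → ℝ) : CrossPolytope c h ∅ where
  vertex _ := 0
  slack _ := AffineMap.const ℝ _ 1
  coordHeight_vertex _ hk := absurd hk (Finset.notMem_empty _)
  vertex_apply_eq_zero _ hk := absurd hk (Finset.notMem_empty _)
  slack_self _ _ hi := absurd hi (Finset.notMem_empty _)
  slack_not_pos _ _ hi := absurd hi (Finset.notMem_empty _)

theorem zero_mem_inner_point : 0 ∈ (point c h).inner := ⟨fun _ _ => rfl, fun _ => one_pos⟩

section Bipyramid

variable [DecidableEq ι] (B : CrossPolytope c h U) {i : ι} (hi : i ∉ U) {ξ : ι → ℝ}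
  (hξ : ξ ∈ B.inner) (hξi : ∀ b, coordHeight c ξ ∈ Set.uIoo (h (i, b)) (h (i, !b)))

/-- The bipyramid with apices of heights `h (i, ·)` on the line through `ξ` in direction `eᵢ`. -/
noncomputable def bipyramid : CrossPolytope c h (insert i U) where
  vertex k := if k.1 = i then ξ + (h k - coordHeight c ξ) • Pi.single i 1 else B.vertex k
  slack s := tilt (B.slack s) ξ i (h (i, s i) - coordHeight c ξ)
  coordHeight_vertex k hk := by
    split_ifs with hki
    · rw [coordHeight_add_smul_single, add_sub_cancel]
    · exact B.coordHeight_vertex k (Finset.mem_of_mem_insert_of_ne hk hki)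
  vertex_apply_eq_zero k hk j hj := by
    rw [Finset.mem_insert, not_or] at hj
    split_ifs with hki
    · simp [hξ.1 j hj.2, hj.1]
    · exact B.vertex_apply_eq_zero k (Finset.mem_of_mem_insert_of_ne hk hki) j hj.2
  slack_self s j hj := by
    split_ifs with hji
    · subst hji
      have hne : h (j, s j) - coordHeight c ξ ≠ 0 := fun hzero => by
        simpa [← sub_eq_zero.1 hzero] using hξi (s j)
      rw [tilt_add_smul_single (hξ.1 j hi), div_self hne, sub_self, mul_zero]
    · have hj := Finset.mem_of_mem_insert_of_ne hj hji
      rw [tilt_of_apply_eq_zero (B.vertex_apply_eq_zero _ hj i hi), B.slack_self s j hj]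
  slack_not_pos s j hj := by
    split_ifs with hji
    · subst hji
      have hne : h (j, !s j) ≠ h (j, s j) := fun heq => by simpa [heq] using hξi (s j)
      rw [tilt_add_smul_single (hξ.1 j hi)]
      exact mul_pos (hξ.2 s) <| sub_pos.2 <|
        sub_div_sub_lt_one_of_mem_uIoo (hξi (s j)) Set.right_mem_uIcc hne
    · have hj := Finset.mem_of_mem_insert_of_ne hj hji
      rw [tilt_of_apply_eq_zero (B.vertex_apply_eq_zero _ hj i hi)]
      exact B.slack_not_pos s j hj

theorem inner_subset_inner_bipyramid : B.inner ⊆ (B.bipyramid hi hξ hξi).inner := fun _ hx =>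
  ⟨fun j hj => hx.1 j fun h => hj (Finset.mem_insert_of_mem h), fun s =>
    (tilt_of_apply_eq_zero (hx.1 i hi)).symm ▸ hx.2 s⟩

theorem uIoo_subset_image_inner_bipyramid :
    Set.uIoo (h (i, true)) (h (i, false)) ⊆ coordHeight c '' (B.bipyramid hi hξ hξi).inner := by
  intro d hd
  refine ⟨ξ + (d - coordHeight c ξ) • Pi.single i 1, ⟨fun j hj => ?_, fun s => ?_⟩, ?_⟩
  · rw [Finset.mem_insert, not_or] at hj
    simp [hξ.1 j hj.2, hj.1]
  · have hds : d ∈ Set.uIoo (h (i, s i)) (h (i, !s i)) := by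
      cases s i
      exacts [Set.uIoo_comm (h (i, true)) _ ▸ hd, hd]
    have hne : d ≠ h (i, s i) := fun heq => by simp [heq] at hds
    rw [bipyramid, tilt_add_smul_single (hξ.1 i hi)]
    exact mul_pos (hξ.2 s) <| sub_pos.2 <|
      sub_div_sub_lt_one_of_mem_uIoo (hξi (s i)) (Set.Ioo_subset_Icc_self hds) hne
  · rw [coordHeight_add_smul_single, add_sub_cancel]

end Bipyramid

theorem exists_insert [DecidableEq ι] (B : CrossPolytope c h U)
    (hB : ∀ j ∈ U, Set.uIoo (h (j, true)) (h (j, false)) ⊆ coordHeight c '' B.inner) {i : ι}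
    (hi : i ∉ U)
    (hne : (Set.uIoo (h (i, true)) (h (i, false)) ∩ coordHeight c '' B.inner).Nonempty) :
    ∃ B' : CrossPolytope c h (insert i U), ∀ j ∈ insert i U,
      Set.uIoo (h (j, true)) (h (j, false)) ⊆ coordHeight c '' B'.inner := by
  obtain ⟨_, hξi, ξ, hξ, rfl⟩ := hne
  have hξi (b : Bool) : coordHeight c ξ ∈ Set.uIoo (h (i, b)) (h (i, !b)) := by
    cases b
    exacts [Set.uIoo_comm (h (i, true)) _ ▸ hξi, hξi]
  refine ⟨B.bipyramid hi hξ hξi, fun j hj => ?_⟩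
  rcases Finset.mem_insert.1 hj with rfl | hj
  · exact B.uIoo_subset_image_inner_bipyramid hi hξ hξi
  · exact (hB j hj).trans (Set.image_mono (B.inner_subset_inner_bipyramid hi hξ hξi))

/-- Connectedness provides, at each stage of the construction by bipyramids, a new direction whose
interval of heights overlaps one of those that are already attained. -/
theorem exists_of_isPreconnected
    (hconn : IsPreconnected (⋃ i, Set.uIoo (h (i, true)) (h (i, false))))
    (hne : ∀ i, (Set.uIoo (h (i, true)) (h (i, false))).Nonempty) {i₀ : ι}
    (hc : c ∈ Set.uIoo (h (i₀, true)) (h (i₀, false))) :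
    ∃ B : CrossPolytope c h Finset.univ, ∀ i,
      Set.uIoo (h (i, true)) (h (i, false)) ⊆ coordHeight c '' B.inner := by
  classical
  let P (U : Finset ι) : Prop := i₀ ∈ U ∧ ∃ B : CrossPolytope c h U, ∀ i ∈ U,
    Set.uIoo (h (i, true)) (h (i, false)) ⊆ coordHeight c '' B.inner
  have hP : P (insert i₀ ∅) :=
    ⟨Finset.mem_insert_self _ _, (point c h).exists_insert (by simp) (by simp)
      ⟨c, hc, 0, zero_mem_inner_point, by simp [coordHeight_apply]⟩⟩
  obtain ⟨U, ⟨hi₀, B, hB⟩, hmax⟩ := (Set.toFinite {U | P U}).exists_maximal ⟨_, hP⟩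
  obtain rfl : U = Finset.univ := by
    by_contra hU
    obtain ⟨j, hj⟩ : ∃ j, j ∉ U := by simpa [Finset.eq_univ_iff_forall] using hU
    have hopen (V : Set ι) : IsOpen (⋃ i ∈ V, Set.uIoo (h (i, true)) (h (i, false))) :=
      isOpen_biUnion fun i _ => isOpen_Ioo
    have hmeet (i : ι) (V : Set ι) (hi : i ∈ V) :
        ((⋃ i, Set.uIoo (h (i, true)) (h (i, false))) ∩
          ⋃ i ∈ V, Set.uIoo (h (i, true)) (h (i, false))).Nonempty :=
      let ⟨t, ht⟩ := hne i
      ⟨t, Set.mem_iUnion_of_mem i ht, Set.mem_biUnion hi ht⟩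
    obtain ⟨t, -, htU, htV⟩ := hconn _ _ (hopen U) (hopen (U : Set ι)ᶜ)
      (by rw [← Set.biUnion_union, Set.union_compl_self, Set.biUnion_univ])
      (hmeet i₀ U hi₀) (hmeet j _ hj)
    obtain ⟨i, hi, hti⟩ := Set.mem_iUnion₂.1 htU
    obtain ⟨k, hk, htk⟩ := Set.mem_iUnion₂.1 htV
    have hPk : P (insert k U) :=
      ⟨Finset.mem_insert_of_mem hi₀, B.exists_insert hB hk ⟨t, htk, hB i hi hti⟩⟩
    exact hk (hmax hPk (Finset.subset_insert k U) (Finset.mem_insert_self k U))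
  exact ⟨B, fun i => hB i (Finset.mem_univ i)⟩

section Dual

variable [DecidableEq ι] (B : CrossPolytope c h Finset.univ) {o : ι → ℝ} (ho : o ∈ B.inner)

/-- The polar dual of a cross-polytope with respect to an interior point. -/
noncomputable def dual : CubeSystem ι (ι → ℝ) where
  slack k := polarFunctional o (B.vertex k)
  vertex s := polarPoint o (B.slack s)
  slack_self s i := by
    rw [polarFunctional_polarPoint (ho.2 s).ne', B.slack_self s i (Finset.mem_univ i), zero_div]
  slack_not_pos s i := by
    rw [polarFunctional_polarPoint (ho.2 s).ne']
    exact div_pos (B.slack_not_pos s i (Finset.mem_univ i)) (ho.2 s)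
  finrank_eq := Module.finrank_fintype_fun_eq_card ℝ

theorem dual_slack_zero (k : FacetLabel ι) : (B.dual ho).slack k 0 = 1 := by
  simp [dual, polarFunctional]

theorem dual_slack_linear_one (k : FacetLabel ι) :
    ((B.dual ho).slack k).linear 1 = coordHeight c o - h k := by
  rw [← B.coordHeight_vertex k (Finset.mem_univ _), coordHeight_apply, coordHeight_apply]
  simp [dual, polarFunctional, Fintype.linearCombination_apply]

theorem crossing_dual (k : FacetLabel ι) :
    (B.dual ho).crossing 0 1 k = (h k - coordHeight c o)⁻¹ := by
  rw [CubeSystem.crossing, dual_slack_zero, dual_slack_linear_one, ← neg_sub, neg_div_neg_eq,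
    one_div]

end Dual

end CrossPolytope

theorem metBefore_inv_inv {s t : ℝ} (hs : s ≠ 0) (ht : t ≠ 0) (hts : t < s) :
    MetBefore s⁻¹ t⁻¹ := by
  rcases hs.lt_or_gt with hs_neg | hs_pos
  · have ht_neg := hts.trans hs_neg
    exact Or.inr ⟨mul_pos_of_neg_of_neg (inv_lt_zero.2 hs_neg) (inv_lt_zero.2 ht_neg),
      (inv_lt_inv_of_neg hs_neg ht_neg).2 hts⟩
  · rcases ht.lt_or_gt with ht_neg | ht_pos
    · exact Or.inl ⟨inv_pos.2 hs_pos, inv_lt_zero.2 ht_neg⟩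
    · exact Or.inr
        ⟨mul_pos (inv_pos.2 hs_pos) (inv_pos.2 ht_pos), (inv_lt_inv₀ hs_pos ht_pos).2 hts⟩

theorem exists_cubeSystem_of_isPreconnected {ι : Type*} [Fintype ι] [Nonempty ι]
    {h : FacetLabel ι → ℝ} (hconn : IsPreconnected (⋃ i, Set.uIoo (h (i, true)) (h (i, false))))
    (hne : ∀ i, h (i, true) ≠ h (i, false)) {l : List (FacetLabel ι)}
    (hl : Enumerates Finset.univ l) (hsort : l.Pairwise fun k k' => h k' < h k) :
    ∃ S : CubeSystem ι (ι → ℝ), (l.map fun k => S.face {k}) ∈ lineShellings (S.face ∅) := by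
  classical
  have hinf (i : ι) : (Set.uIoo (h (i, true)) (h (i, false))).Infinite :=
    Set.Ioo_infinite (min_lt_max.2 (hne i))
  obtain ⟨i₀⟩ := ‹Nonempty ι›
  obtain ⟨c, hc⟩ := (hinf i₀).nonempty
  obtain ⟨B, hB⟩ := CrossPolytope.exists_of_isPreconnected hconn (fun i => (hinf i).nonempty) hc
  obtain ⟨d, hd, hdh⟩ := ((hinf i₀).sdiff (Set.finite_range h)).nonempty
  obtain ⟨o, ho, rfl⟩ := hB i₀ hd
  have hgeneric (k) : h k - coordHeight c o ≠ 0 := fun hk => hdh ⟨k, sub_eq_zero.1 hk⟩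
  refine ⟨B.dual ho, 0, 1,
    CubeSystem.isLineShellingAlong_iff.2 ⟨?_, l, hl, fun k => ?_, hsort.imp fun hlt => ?_, rfl⟩⟩
  · exact mem_interior_slackFace_empty fun k => B.dual_slack_zero ho k ▸ one_pos
  · rw [B.dual_slack_linear_one ho, ← neg_sub]
    exact neg_ne_zero.2 (hgeneric k)
  · rw [B.crossing_dual, B.crossing_dual]
    exact metBefore_inv_inv (hgeneric _) (hgeneric _) (sub_lt_sub_right hlt _)

theorem CubeSystem.exists_realization {ι E : Type*} [Fintype ι] [Nonempty ι]
    [NormedAddCommGroup E] [NormedSpace ℝ E] [FiniteDimensional ℝ E] (S : CubeSystem ι E)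
    {L : List (Set E)} (hL : L ∈ shellings (S.face ∅)) :
    ∃ Q : Set (ι → ℝ), IsPolytope Q ∧
      ∃ e : Face (S.face ∅) ≃o Face Q, ∃ L' ∈ lineShellings Q, Corresponds e L L' := by
  classical
  obtain ⟨l, hl, hind, rfl⟩ := isShelling_face_empty_iff.1 hL
  have hsort : l.Pairwise fun k k' => -(l.idxOf k' : ℝ) < -l.idxOf k :=
    (pairwise_idxOf hl.1).imp neg_lt_neg
  have hne (i : ι) : -(l.idxOf (i, true) : ℝ) ≠ -l.idxOf (i, false) := fun heq => by
    have := (List.idxOf_inj ((hl.2 (i, true)).2 (Finset.mem_univ i))).1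
      (Nat.cast_injective (neg_injective heq))
    simp at this
  obtain ⟨S', hS'⟩ := exists_cubeSystem_of_isPreconnected
    (hind.isPreconnected_iUnion_uIoo hl hsort) hne hl hsort
  refine ⟨S'.face ∅, S'.isPolytope_face_empty, S.faceOrderIso.trans S'.faceOrderIso.symm, _, hS',
    ?_⟩
  rw [Corresponds, List.forall₂_map_left_iff, List.forall₂_map_right_iff, List.forall₂_same]
  exact fun k _ => ⟨isExposed_slackFace (Set.empty_subset _),
    S.coe_faceOrderIso_symm_faceOrderIso S' (consistent_singleton k) _⟩

end Realization

section ValidOrder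

/- The equation is that of the member through `p` of the pencil of `f = 0` and `g = 0`. -/
theorem mem_affineSpan_insert_iff {𝕜 V P : Type*} [Field 𝕜] [AddCommGroup V] [Module 𝕜 V]
    [AddTorsor V P] {f g : P →ᵃ[𝕜] 𝕜} {p o x : P} (hp : f p ≠ 0) (hfo : f o = 0) (hgo : g o = 0) :
    x ∈ affineSpan 𝕜 (insert p {y | f y = 0 ∧ g y = 0}) ↔ g p * f x = f p * g x := by
  constructor
  · intro hx
    have himage := AffineSubspace.mem_map_of_mem (g p • f - f p • g) hx
    rw [AffineSubspace.map_span] at himage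
    have hsub : (g p • f - f p • g) '' insert p {y | f y = 0 ∧ g y = 0} ⊆ {0} := by
      rintro _ ⟨y, rfl | ⟨hfy, hgy⟩, rfl⟩
      · simp [mul_comm]
      · simp [hfy, hgy]
    simpa [sub_eq_zero] using affineSpan_mono 𝕜 hsub himage
  · intro hx
    have hzero {e : P →ᵃ[𝕜] 𝕜} (he : e o = 0) (hex : e x = f x / f p * e p) :
        e ((f x / f p) • (o -ᵥ p) +ᵥ x) = 0 := by
      rw [AffineMap.map_vadd, map_smul, e.linearMap_vsub, he, hex, vsub_eq_sub, vadd_eq_add,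
        smul_eq_mul]
      ring
    have hmem : (f x / f p) • (o -ᵥ p) +ᵥ x ∈ affineSpan 𝕜 (insert p {y | f y = 0 ∧ g y = 0}) :=
      subset_affineSpan 𝕜 _ (Set.mem_insert_of_mem _
        ⟨hzero hfo (by field), hzero hgo (by field_simp; linear_combination -hx)⟩)
    refine (AffineSubspace.vadd_mem_iff_mem_of_mem_direction ?_).1 hmem
    exact Submodule.smul_mem _ _ (AffineSubspace.vsub_mem_direction
      (subset_affineSpan 𝕜 _ (Set.mem_insert_of_mem _ ⟨hfo, hgo⟩))
      (subset_affineSpan 𝕜 _ (Set.mem_insert _ _)))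

/-- The hyperplane `x i = ρ * x j` (a coordinate hyperplane for `ρ = 0`). -/
def signedHyperplane {ι : Type*} (i j : ι) (ρ : SignType) : Submodule ℝ (ι → ℝ) :=
  LinearMap.ker ((LinearMap.proj i : (ι → ℝ) →ₗ[ℝ] ℝ) - (ρ : ℝ) • LinearMap.proj j)

theorem mem_signedHyperplane {ι : Type*} {i j : ι} {ρ : SignType} {x : ι → ℝ} :
    x ∈ signedHyperplane i j ρ ↔ x i = ρ * x j := by
  simp [signedHyperplane, sub_eq_zero]

theorem mem_coxeterB_iff {n : ℕ} {W : Submodule ℝ (Fin n → ℝ)} :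
    W ∈ coxeterB n ↔ ∃ i j ρ, (ρ ≠ 0 → i ≠ j) ∧ W = signedHyperplane i j ρ := by
  simp only [coxeterB, Submodule.ext_iff, mem_signedHyperplane]
  constructor
  · rintro ((⟨i, h⟩ | ⟨i, j, hij, h⟩) | ⟨i, j, hij, h⟩)
    · exact ⟨i, i, 0, by simp, by simpa using h⟩
    · exact ⟨i, j, 1, fun _ => hij.ne, by simpa using h⟩
    · exact ⟨i, j, -1, fun _ => hij.ne, by simpa using h⟩
  · rintro ⟨i, j, ρ, hij, h⟩
    cases ρ
    · exact Or.inl (Or.inl ⟨i, by simpa using h⟩)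
    · rcases (hij (by decide)).lt_or_gt with hij | hji
      · exact Or.inr ⟨i, j, hij, by simpa using h⟩
      · exact Or.inr ⟨j, i, hji, by simpa [eq_neg_iff_add_eq_zero, add_comm] using h⟩
    · rcases (hij (by decide)).lt_or_gt with hij | hji
      · exact Or.inl (Or.inr ⟨i, j, hij, by simpa using h⟩)
      · exact Or.inl (Or.inr ⟨j, i, hji, by simpa [eq_comm] using h⟩)

theorem visArrangement_face_empty {ι E : Type*} [Fintype ι] [NormedAddCommGroup E]
    [NormedSpace ℝ E] [FiniteDimensional ℝ E] (S : CubeSystem ι E) :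
    visArrangement (S.face ∅) = Set.range fun k => affineSpan ℝ (S.face {k}) := by
  ext H
  simp only [visArrangement, CubeSystem.isFacet_face_empty_iff, Set.mem_ofPred_eq, Set.mem_range]
  constructor
  · rintro ⟨_, ⟨k, rfl⟩, rfl⟩
    exact ⟨k, rfl⟩
  · rintro ⟨k, rfl⟩
    exact ⟨_, ⟨k, rfl⟩, rfl⟩

/-- The affine span of a facet of the standard cube. -/
noncomputable def stdFacetSpan {ι : Type*} [Fintype ι] (k : FacetLabel ι) :
    AffineSubspace ℝ (ι → ℝ) :=
  affineSpan ℝ ((stdCubeSystem ι).face {k})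

section FacetSpan

variable {ι : Type*} [Fintype ι] {k k' : FacetLabel ι} {x : ι → ℝ}

theorem mem_stdFacetSpan : x ∈ stdFacetSpan k ↔ (stdCubeSystem ι).slack k x = 0 :=
  (stdCubeSystem ι).mem_affineSpan_face_singleton_iff

theorem ite_mem_stdFacetSpan : (fun _ => if k.2 then 1 else 0) ∈ stdFacetSpan k := by
  obtain ⟨i, _ | _⟩ := k <;> simp [mem_stdFacetSpan]

theorem mem_direction_stdFacetSpan : x ∈ (stdFacetSpan k).direction ↔ x k.1 = 0 := by
  rw [← AffineSubspace.vadd_mem_iff_mem_direction x ite_mem_stdFacetSpan, mem_stdFacetSpan]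
  obtain ⟨i, _ | _⟩ := k <;> simp

theorem stdFacetSpan_parallel_iff : (stdFacetSpan k).Parallel (stdFacetSpan k') ↔ k.1 = k'.1 := by
  classical
  have hne_bot (k : FacetLabel ι) : stdFacetSpan k ≠ ⊥ := fun h =>
    AffineSubspace.notMem_bot ℝ _ _ (h ▸ ite_mem_stdFacetSpan)
  rw [AffineSubspace.parallel_iff_direction_eq_and_eq_bot_iff_eq_bot]
  simp only [hne_bot, and_true, SetLike.ext_iff, mem_direction_stdFacetSpan]
  refine ⟨fun h => ?_, fun h x => by rw [h]⟩
  simpa [Pi.single_apply] using h (Pi.single k'.1 1)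

theorem affineSpan_insert_center_inter_stdFacetSpan (h : k.1 ≠ k'.1) :
    affineSpan ℝ (insert (fun _ => 1 / 2 : ι → ℝ) (stdFacetSpan k ∩ stdFacetSpan k')) =
      AffineSubspace.mk' (fun _ => 1 / 2 : ι → ℝ)
        (signedHyperplane k.1 k'.1 (if k.2 = k'.2 then 1 else -1)) := by
  classical
  have hinter : (stdFacetSpan k ∩ stdFacetSpan k' : Set (ι → ℝ)) =
      {y | (stdCubeSystem ι).slack k y = 0 ∧ (stdCubeSystem ι).slack k' y = 0} := by
    ext y
    simp [mem_stdFacetSpan]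
  have hcenter (k : FacetLabel ι) : (stdCubeSystem ι).slack k (fun _ => 1 / 2) = 1 / 2 := by
    obtain ⟨i, _ | _⟩ := k <;> norm_num
  let o := Function.update (fun _ => if k'.2 then 1 else 0 : ι → ℝ) k.1 (if k.2 then 1 else 0)
  have hok : (stdCubeSystem ι).slack k o = 0 := by
    obtain ⟨i, _ | _⟩ := k <;> simp [o]
  have hok' : (stdCubeSystem ι).slack k' o = 0 := by
    obtain ⟨i, _ | _⟩ := k' <;> simp [o, Ne.symm h]
  ext x
  rw [hinter, mem_affineSpan_insert_iff (by norm_num [hcenter]) hok hok', hcenter, hcenter,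
    AffineSubspace.mem_mk', mem_signedHyperplane]
  obtain ⟨i, _ | _⟩ := k <;> obtain ⟨j, _ | _⟩ := k' <;> constructor <;> intro h <;>
    simp at h ⊢ <;> linarith

end FacetSpan

theorem validOrderArrangement_stdCube (n : ℕ) :
    validOrderArrangement (visArrangement (stdCube n)) (cubeCenter n) =
      (fun W => AffineSubspace.mk' (cubeCenter n) W) '' coxeterB n := by
  have hspan {k k' : FacetLabel (Fin n)} (hk : k.1 ≠ k'.1) :
      AffineSubspace.mk' (cubeCenter n)
        (signedHyperplane k.1 k'.1 (if k.2 = k'.2 then 1 else -1)) =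
          affineSpan ℝ (insert (cubeCenter n) (stdFacetSpan k ∩ stdFacetSpan k')) :=
    (affineSpan_insert_center_inter_stdFacetSpan hk).symm
  have hdirection (k : FacetLabel (Fin n)) (j : Fin n) :
      (stdFacetSpan k).direction = signedHyperplane k.1 j 0 := by
    ext x
    simp [mem_direction_stdFacetSpan, mem_signedHyperplane]
  have hvis : visArrangement (stdCube n) = Set.range stdFacetSpan :=
    stdCubeSystem_face_empty n ▸ visArrangement_face_empty _
  rw [hvis]
  ext K
  constructor
  · rintro (⟨_, ⟨k, rfl⟩, _, ⟨k', rfl⟩, hpar, rfl⟩ | ⟨_, ⟨k, rfl⟩, _, -, -, -, rfl⟩)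
    · rw [stdFacetSpan_parallel_iff] at hpar
      exact ⟨_, mem_coxeterB_iff.2 ⟨_, _, _, fun _ => hpar, rfl⟩, hspan hpar⟩
    · exact ⟨_, mem_coxeterB_iff.2 ⟨_, _, _, by simp, hdirection k k.1⟩, rfl⟩
  · rintro ⟨W, hW, rfl⟩
    obtain ⟨i, j, ρ, hij, rfl⟩ := mem_coxeterB_iff.1 hW
    rcases eq_or_ne ρ 0 with rfl | hρ
    · have hne : stdFacetSpan (i, true) ≠ stdFacetSpan (i, false) := fun heq => by
        have hmem := ite_mem_stdFacetSpan (k := ((i, true) : FacetLabel (Fin n)))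
        rw [heq, mem_stdFacetSpan] at hmem
        simp at hmem
      exact Or.inr ⟨_, ⟨_, rfl⟩, _, ⟨_, rfl⟩, hne, stdFacetSpan_parallel_iff.2 rfl,
        by rw [hdirection _ j]⟩
    · obtain ⟨b, rfl⟩ : ∃ b, ρ = if true = b then 1 else -1 := by
        clear hW hij
        decide +revert
      exact Or.inl ⟨_, ⟨(i, true), rfl⟩, _, ⟨(j, b), rfl⟩,
        mt stdFacetSpan_parallel_iff.1 (hij hρ), hspan (k := (i, true)) (k' := (j, b)) (hij hρ)⟩

end ValidOrder

section CharacteristicPolynomial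

variable {E : Type*} [NormedAddCommGroup E] [NormedSpace ℝ E] {A : Set (AffineSubspace ℝ E)}

namespace IntersectionPoset

theorem whole_le (Y : IntersectionPoset A) : whole A ≤ Y :=
  show (OrderDual.ofDual Y).1 ≤ ⊤ from le_top

theorem mem_sInf_sep_mem (z : E) : z ∈ sInf {H ∈ A | z ∈ H} :=
  (AffineSubspace.mem_sInf_iff _ _).2 fun _ hH => hH.2

/-- The smallest flat of the arrangement `A` that contains `z`. -/
def flatOf (A : Set (AffineSubspace ℝ E)) (z : E) : IntersectionPoset A :=
  OrderDual.toDual ⟨sInf {H ∈ A | z ∈ H},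
    fun h => AffineSubspace.notMem_bot ℝ _ _ (h ▸ mem_sInf_sep_mem z), _, Set.sep_subset _ _, rfl⟩

theorem le_flatOf_iff {Y : IntersectionPoset A} {z : E} :
    Y ≤ flatOf A z ↔ z ∈ (OrderDual.ofDual Y).1 := by
  change sInf {H ∈ A | z ∈ H} ≤ (OrderDual.ofDual Y).1 ↔ _
  refine ⟨fun h => h (mem_sInf_sep_mem z), fun hz => ?_⟩
  obtain ⟨-, B, hB, hY⟩ := (OrderDual.ofDual Y).2
  rw [hY] at hz ⊢
  exact sInf_le_sInf fun H hH => ⟨hB hH, (AffineSubspace.mem_sInf_iff _ _).1 hz H hH⟩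

theorem whole_eq_flatOf_iff (htop : ⊤ ∉ A) {z : E} :
    whole A = flatOf A z ↔ ∀ H ∈ A, z ∉ H := by
  rw [← OrderDual.ofDual_inj, Subtype.ext_iff, eq_comm]
  change sInf {H ∈ A | z ∈ H} = ⊤ ↔ _
  rw [sInf_eq_top]
  exact ⟨fun h H hH hz => htop (h H ⟨hH, hz⟩ ▸ hH), fun h H hH => absurd hH.2 (h H hH.1)⟩

open Classical in
theorem sum_mu_filter_mem [Fintype (IntersectionPoset A)]
    [LocallyFiniteOrder (IntersectionPoset A)] (htop : ⊤ ∉ A) (z : E) :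
    ∑ Y : IntersectionPoset A with z ∈ (OrderDual.ofDual Y).1, IncidenceAlgebra.mu ℤ (whole A) Y =
      if ∀ H ∈ A, z ∉ H then 1 else 0 := by
  have hIcc : ({Y | z ∈ (OrderDual.ofDual Y).1} : Finset (IntersectionPoset A)) =
      Finset.Icc (whole A) (flatOf A z) := by
    ext Y
    simp [le_flatOf_iff, whole_le]
  rw [hIcc, IncidenceAlgebra.sum_Icc_mu_right]
  simp only [whole_eq_flatOf_iff htop]

end IntersectionPoset

open Classical in
theorem eval_moebiusPoly [Fintype (IntersectionPoset A)] [LocallyFiniteOrder (IntersectionPoset A)]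
    (htop : ⊤ ∉ A) {Z : Finset E} {q : ℤ} (hZ : ∀ Y ∈ intersectionSet A,
      ({z ∈ Z | z ∈ Y}.card : ℤ) = q ^ Module.finrank ℝ Y.direction) :
    (moebiusPoly A).eval q = {z ∈ Z | ∀ H ∈ A, z ∉ H}.card := by
  calc (moebiusPoly A).eval q
      = ∑ Y : IntersectionPoset A, ∑ z ∈ Z, if z ∈ (OrderDual.ofDual Y).1 then
          IncidenceAlgebra.mu ℤ (IntersectionPoset.whole A) Y else 0 := by
        simp only [moebiusPoly, eval_finsetSum, eval_mul, eval_C, eval_pow, eval_X]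
        refine Finset.sum_congr rfl fun Y _ => ?_
        rw [← hZ _ (OrderDual.ofDual Y).2, ← Finset.sum_filter, Finset.sum_const, nsmul_eq_mul,
          mul_comm]
    _ = ∑ z ∈ Z, if ∀ H ∈ A, z ∉ H then 1 else 0 := by
        rw [Finset.sum_comm]
        refine Finset.sum_congr rfl fun z _ => ?_
        rw [← Finset.sum_filter, IntersectionPoset.sum_mu_filter_mem htop]
    _ = {z ∈ Z | ∀ H ∈ A, z ∉ H}.card := by rw [Finset.sum_boole]

open Classical in
theorem eval_arrangementCharPoly (hA : A.Finite) (htop : ⊤ ∉ A) {Z : Finset E} {q : ℤ}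
    (hZ : ∀ Y ∈ intersectionSet A,
      ({z ∈ Z | z ∈ Y}.card : ℤ) = q ^ Module.finrank ℝ Y.direction) :
    (arrangementCharPoly A).eval q = {z ∈ Z | ∀ H ∈ A, z ∉ H}.card := by
  let _ : Finite (IntersectionPoset A) := intersectionPoset_finite hA
  let _ : Fintype (IntersectionPoset A) := Fintype.ofFinite _
  let _ : LocallyFiniteOrder (IntersectionPoset A) := Fintype.toLocallyFiniteOrder
  rw [arrangementCharPoly, dif_pos hA]
  exact eval_moebiusPoly htop hZ

end CharacteristicPolynomial

section CoxeterArrangement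

/-- The coordinates in `J` can be prescribed freely on `V`, and every coordinate vanishes on `V` or
agrees there up to sign with one of those in `J`. -/
structure IsSignedBasis {ι : Type*} (V : Submodule ℝ (ι → ℝ)) (J : Finset ι) : Prop where
  exists_apply_eq : ∀ i, ∃ j, ∃ σ : SignType, (σ ≠ 0 → j ∈ J) ∧ ∀ x ∈ V, x i = σ * x j
  exists_mem_forall_eq : ∀ u : ι → ℝ, ∃ x ∈ V, ∀ j ∈ J, x j = u j

namespace IsSignedBasis

variable {ι : Type*} {V : Submodule ℝ (ι → ℝ)} {J : Finset ι}

theorem top [Fintype ι] : IsSignedBasis (⊤ : Submodule ℝ (ι → ℝ)) Finset.univ where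
  exists_apply_eq i := ⟨i, 1, fun _ => Finset.mem_univ _, fun x _ => by simp⟩
  exists_mem_forall_eq u := ⟨u, trivial, fun _ _ => rfl⟩

section Inf

variable (hV : IsSignedBasis V J)
include hV

theorem inf_signedHyperplane [DecidableEq ι] {a b : ι} {σ : SignType} (ha : a ∈ J)
    (hb : σ ≠ 0 → b ∈ J.erase a) :
    IsSignedBasis (V ⊓ signedHyperplane a b σ) (J.erase a) where
  exists_apply_eq i := by
    obtain ⟨j, τ, hτ, hi⟩ := hV.exists_apply_eq i
    rcases eq_or_ne j a with rfl | hja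
    · refine ⟨b, τ * σ, fun h => hb (right_ne_zero_of_mul h), fun x hx => ?_⟩
      rw [hi x hx.1, mem_signedHyperplane.1 hx.2, SignType.coe_mul, mul_assoc]
    · exact ⟨j, τ, fun h => Finset.mem_erase.2 ⟨hja, hτ h⟩, fun x hx => hi x hx.1⟩
  exists_mem_forall_eq u := by
    obtain ⟨x, hx, hxu⟩ := hV.exists_mem_forall_eq (Function.update u a (σ * u b))
    have hxu' (j) (hj : j ∈ J.erase a) : x j = u j := by
      rw [hxu j (Finset.mem_of_mem_erase hj), Function.update_of_ne (Finset.ne_of_mem_erase hj)]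
    refine ⟨x, ⟨hx, mem_signedHyperplane.2 ?_⟩, hxu'⟩
    rw [hxu a ha, Function.update_self]
    rcases eq_or_ne σ 0 with rfl | hσ
    · simp
    · rw [hxu' b (hb hσ)]

theorem exists_inf_signedHyperplane_of_mem {a b : ι} {σ : SignType} (ha : a ∈ J)
    (hb : σ ≠ 0 → b ∈ J) : ∃ J', IsSignedBasis (V ⊓ signedHyperplane a b σ) J' := by
  classical
  rcases ne_or_eq a b with hab | rfl
  · exact ⟨_, hV.inf_signedHyperplane ha fun hσ => Finset.mem_erase.2 ⟨hab.symm, hb hσ⟩⟩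
  · obtain rfl | hσ := eq_or_ne σ 1
    · have htop : signedHyperplane a a 1 = ⊤ := by
        ext x
        simp [mem_signedHyperplane]
      exact ⟨J, by rwa [htop, inf_top_eq]⟩
    · have hcoord : signedHyperplane a a σ = signedHyperplane a a 0 := by
        ext x
        cases σ <;> simp_all [mem_signedHyperplane, self_eq_neg]
      rw [hcoord]
      exact ⟨_, hV.inf_signedHyperplane ha (by simp)⟩

theorem exists_inf_signedHyperplane (i j : ι) (ρ : SignType) :
    ∃ J', IsSignedBasis (V ⊓ signedHyperplane i j ρ) J' := by
  obtain ⟨a, σ, hσ, hi⟩ := hV.exists_apply_eq i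
  obtain ⟨b, τ, hτ, hj⟩ := hV.exists_apply_eq j
  have hinf {W : Submodule ℝ (ι → ℝ)}
      (hW : ∀ x : ι → ℝ, (σ * x a = (ρ * τ : SignType) * x b ↔ x ∈ W)) :
      V ⊓ signedHyperplane i j ρ = V ⊓ W := by
    ext x
    refine and_congr_right fun hx => ?_
    rw [SetLike.mem_coe, SetLike.mem_coe, ← hW, mem_signedHyperplane, hi x hx, hj x hx,
      SignType.coe_mul, mul_assoc]
  rcases eq_or_ne σ 0 with rfl | hσ0
  · rcases eq_or_ne (ρ * τ) 0 with hρτ | hρτ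
    · exact ⟨J, by rwa [hinf (W := ⊤) (by simp [hρτ]), inf_top_eq]⟩
    · rw [hinf (W := signedHyperplane b b 0) fun x => ?_]
      · exact hV.exists_inf_signedHyperplane_of_mem (hτ (right_ne_zero_of_mul hρτ)) (by simp)
      · rw [mem_signedHyperplane]
        generalize ρ * τ = κ at *
        cases κ <;> simp_all [eq_comm]
  · rw [hinf (W := signedHyperplane a b (σ * (ρ * τ))) fun x => ?_]
    · exact hV.exists_inf_signedHyperplane_of_mem (hσ hσ0)
        fun h => hτ (right_ne_zero_of_mul (right_ne_zero_of_mul h))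
    · rw [mem_signedHyperplane]
      generalize ρ * τ = κ
      cases σ <;> simp_all [neg_eq_iff_eq_neg]

end Inf

section Restrict

variable (hV : IsSignedBasis V J)
include hV

theorem restrict_injOn : Set.InjOn J.restrict (V : Set (ι → ℝ)) := by
  intro x hx y hy hxy
  funext i
  obtain ⟨j, σ, hσ, hi⟩ := hV.exists_apply_eq i
  rw [hi x hx, hi y hy]
  rcases eq_or_ne σ 0 with rfl | hσ0
  · simp
  · rw [show x j = y j from congrFun hxy ⟨j, hσ hσ0⟩]

theorem exists_restrict_eq (u : J → ℝ) : ∃ x ∈ V, J.restrict x = u := by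
  classical
  obtain ⟨x, hx, hxu⟩ := hV.exists_mem_forall_eq fun j => if h : j ∈ J then u ⟨j, h⟩ else 0
  exact ⟨x, hx, funext fun j => (hxu j j.2).trans (dif_pos j.2)⟩

theorem finrank_eq : Module.finrank ℝ V = J.card := by
  let restrict : V →ₗ[ℝ] (J → ℝ) := (LinearMap.funLeft ℝ ℝ Subtype.val).comp V.subtype
  have hbij : Function.Bijective restrict :=
    ⟨fun x y hxy => Subtype.ext (hV.restrict_injOn x.2 y.2 hxy),
      fun u => let ⟨x, hx, hxu⟩ := hV.exists_restrict_eq u; ⟨⟨x, hx⟩, hxu⟩⟩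
  rw [(LinearEquiv.ofBijective restrict hbij).finrank_eq, Module.finrank_fintype_fun_eq_card,
    Fintype.card_coe]

end Restrict

end IsSignedBasis

section IntegerPoints

variable {ι : Type*}

theorem signs_mul_succ_injective (m : ℕ) : Function.Injective
    fun (t : (ι → ℤˣ) × (ι ↪ Fin m)) i => (t.1 i * (t.2 i + 1) : ℤ) := by
  rintro ⟨s, e⟩ ⟨s', e'⟩ heq
  have he (i) : e i = e' i := by
    have habs := congrArg Int.natAbs (congrFun heq i)
    simp only [Int.natAbs_mul, Int.units_natAbs, one_mul] at habs
    exact Fin.ext (by lia)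
  refine Prod.ext (funext fun i => Units.ext ?_) (Function.Embedding.ext he)
  have hi := congrFun heq i
  simp only [he] at hi
  exact mul_right_cancel₀ (by lia) hi

variable [Fintype ι] [DecidableEq ι]

variable (ι) in
/-- The integer points with coordinates between `-m` and `m`. -/
noncomputable def intBox (m : ℕ) : Finset (ι → ℤ) :=
  Fintype.piFinset fun _ => Finset.Icc (-m) m

theorem mem_intBox {m : ℕ} {z : ι → ℤ} : z ∈ intBox ι m ↔ ∀ i, |z i| ≤ m := by
  simp [intBox, abs_le]

theorem card_intBox (m : ℕ) : (intBox ι m).card = (2 * m + 1) ^ Fintype.card ι := by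
  have hcard : ((m : ℤ) + 1 + m).toNat = 2 * m + 1 := by lia
  simp [intBox, Fintype.card_piFinset, hcard]

open Classical in
theorem IsSignedBasis.card_filter_intBox {V : Submodule ℝ (ι → ℝ)} {J : Finset ι}
    (hV : IsSignedBasis V J) (m : ℕ) :
    {z ∈ intBox ι m | Int.cast ∘ z ∈ V}.card = (2 * m + 1) ^ J.card := by
  rw [← Fintype.card_coe J, ← card_intBox]
  refine Finset.card_nbij J.restrict (fun z hz => ?_) (fun z hz z' hz' heq => ?_) fun w hw => ?_
  · exact mem_intBox.2 fun j => mem_intBox.1 (Finset.mem_filter.1 hz).1 j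
  · refine Int.cast_injective.comp_left (hV.restrict_injOn (Finset.mem_filter.1 hz).2
      (Finset.mem_filter.1 hz').2 (funext fun j => ?_))
    exact congrArg Int.cast (congrFun heq j)
  · obtain ⟨x, hx, hxw⟩ := hV.exists_restrict_eq (Int.cast ∘ w)
    have hlift (i) : ∃ a : ℤ, |a| ≤ m ∧ (a : ℝ) = x i := by
      obtain ⟨j, σ, hσ, hi⟩ := hV.exists_apply_eq i
      rcases eq_or_ne σ 0 with rfl | hσ0
      · exact ⟨0, by simp, by simp [hi x hx]⟩
      · have hxj : x j = w ⟨j, hσ hσ0⟩ := congrFun hxw ⟨j, hσ hσ0⟩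
        have hwj := mem_intBox.1 hw ⟨j, hσ hσ0⟩
        refine ⟨σ * w ⟨j, hσ hσ0⟩, ?_, by rw [hi x hx, hxj]; cases σ <;> simp⟩
        cases σ <;> simp_all
    choose z hz hzx using hlift
    refine ⟨z, Finset.mem_coe.2 (Finset.mem_filter.2 ⟨mem_intBox.2 hz, ?_⟩), funext fun j => ?_⟩
    · rwa [show Int.cast ∘ z = x from funext hzx]
    · exact Int.cast_injective (α := ℝ) ((hzx j).trans (congrFun hxw j))

theorem exists_signs_mul_succ_eq_iff {m : ℕ} {z : ι → ℤ} :
    (∃ t : (ι → ℤˣ) × (ι ↪ Fin m), (fun i => (t.1 i * (t.2 i + 1) : ℤ)) = z) ↔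
      z ∈ intBox ι m ∧ (∀ i, z i ≠ 0) ∧ Function.Injective fun i => |z i| := by
  simp only [mem_intBox, Int.abs_eq_natAbs, Nat.cast_le]
  constructor
  · rintro ⟨⟨s, e⟩, rfl⟩
    have habs (i) : (s i * (e i + 1) : ℤ).natAbs = e i + 1 := by
      rw [Int.natAbs_mul, Int.units_natAbs, one_mul]
      exact Int.natAbs_natCast (e i + 1)
    simp only [habs, ← Int.natAbs_ne_zero]
    exact ⟨fun i => (e i).2, fun i => Nat.succ_ne_zero _,
      fun i j hij => e.injective (Fin.ext (by simpa using hij))⟩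
  · rintro ⟨hm, h0, hinj⟩
    have hpos (i) : 0 < (z i).natAbs := Int.natAbs_pos.2 (h0 i)
    choose s hs using fun i => (Int.associated_natAbs (z i)).symm
    have he (i) : (z i).natAbs - 1 < m := by grind
    let e : ι ↪ Fin m := ⟨fun i => ⟨(z i).natAbs - 1, he i⟩, fun i j hij => by
      have := Fin.mk.inj hij
      grind [Function.Injective]⟩
    refine ⟨(s, e), funext fun i => ?_⟩
    have hei : ((e i : ℕ) + 1 : ℤ) = (z i).natAbs := by
      exact_mod_cast Nat.sub_add_cancel (hpos i)
    rw [hei, mul_comm, hs]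

theorem card_filter_injective_abs_intBox (m : ℕ) :
    {z ∈ intBox ι m | (∀ i, z i ≠ 0) ∧ Function.Injective fun i => |z i|}.card =
      2 ^ Fintype.card ι * m.descFactorial (Fintype.card ι) := by
  have himage : {z ∈ intBox ι m | (∀ i, z i ≠ 0) ∧ Function.Injective fun i => |z i|} =
      Finset.univ.image fun (t : (ι → ℤˣ) × (ι ↪ Fin m)) i => (t.1 i * (t.2 i + 1) : ℤ) := by
    ext z
    simp only [Finset.mem_filter, ← exists_signs_mul_succ_eq_iff, Finset.mem_image,
      Finset.mem_univ, true_and]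
  rw [himage, Finset.card_image_of_injective _ (signs_mul_succ_injective m), Finset.card_univ,
    Fintype.card_prod, Fintype.card_fun, Fintype.card_units_int, Fintype.card_embedding_eq,
    Fintype.card_fin]

end IntegerPoints

section CoxeterB

variable {n : ℕ}

theorem finite_coxeterB : (coxeterB n).Finite := by
  refine (Set.finite_range fun t : Fin n × Fin n × SignType =>
    signedHyperplane t.1 t.2.1 t.2.2).subset fun W hW => ?_
  obtain ⟨i, j, ρ, -, rfl⟩ := mem_coxeterB_iff.1 hW
  exact ⟨(i, j, ρ), rfl⟩

theorem top_notMem_coxeterB : ⊤ ∉ coxeterB n := by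
  intro htop
  obtain ⟨i, j, ρ, hij, hW⟩ := mem_coxeterB_iff.1 htop
  have hi : (Pi.single i 1 : Fin n → ℝ) ∈ signedHyperplane i j ρ := hW ▸ Submodule.mem_top
  rw [mem_signedHyperplane, Pi.single_eq_same] at hi
  rcases eq_or_ne ρ 0 with rfl | hρ
  · simp at hi
  · simp [(hij hρ).symm] at hi

theorem forall_coxeterB_intCast_notMem_iff {z : Fin n → ℤ} :
    (∀ W ∈ coxeterB n, Int.cast ∘ z ∉ W) ↔ (∀ i, z i ≠ 0) ∧ Function.Injective fun i => |z i| := by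
  have hmem (i j) (ρ : SignType) :
      Int.cast ∘ z ∈ signedHyperplane i j ρ ↔ z i = (ρ : ℤ) * z j := by
    rw [mem_signedHyperplane]
    cases ρ <;> simp [-Int.cast_inj] <;> norm_cast
  constructor
  · intro hz
    refine ⟨fun i hi => hz _ (mem_coxeterB_iff.2 ⟨i, i, 0, by simp, rfl⟩) ?_, fun i j hij => ?_⟩
    · simp [hmem, hi]
    · by_contra hne
      rcases abs_eq_abs.1 hij with heq | heq
      · exact hz _ (mem_coxeterB_iff.2 ⟨i, j, 1, fun _ => hne, rfl⟩) (by simp [hmem, heq])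
      · exact hz _ (mem_coxeterB_iff.2 ⟨i, j, -1, fun _ => hne, rfl⟩) (by simp [hmem, heq])
  · rintro ⟨h0, hinj⟩ W hW hzW
    obtain ⟨i, j, ρ, hij, rfl⟩ := mem_coxeterB_iff.1 hW
    rw [hmem] at hzW
    rcases eq_or_ne ρ 0 with rfl | hρ
    · exact h0 i (by simpa using hzW)
    · exact hij hρ (hinj (by cases ρ <;> simp_all))

theorem exists_isSignedBasis_sInf {p : Fin n → ℝ} {B : Set (AffineSubspace ℝ (Fin n → ℝ))}
    (hB : B ⊆ (fun W => AffineSubspace.mk' p W) '' coxeterB n) :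
    ∃ V J, IsSignedBasis V J ∧ sInf B = AffineSubspace.mk' p V := by
  have hfin : B.Finite := (finite_coxeterB.image _).subset hB
  induction B, hfin using Set.Finite.induction_on with
  | empty => exact ⟨⊤, _, .top, by ext x; simp⟩
  | @insert H B _ _ ih =>
    obtain ⟨V, J, hV, hVB⟩ := ih ((Set.subset_insert _ _).trans hB)
    obtain ⟨W, hW, rfl⟩ := hB (Set.mem_insert H B)
    obtain ⟨i, j, ρ, -, rfl⟩ := mem_coxeterB_iff.1 hW
    obtain ⟨J', hJ'⟩ := hV.exists_inf_signedHyperplane i j ρ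
    refine ⟨_, J', hJ', ?_⟩
    ext x
    rw [sInf_insert, hVB]
    simp only [AffineSubspace.mem_inf_iff, AffineSubspace.mem_mk', Submodule.mem_inf]
    exact and_comm

theorem prod_sub_odd_eq_descFactorial (m n : ℕ) :
    ∏ k ∈ Finset.Icc 1 n, ((2 * m + 1 : ℤ) - (2 * k - 1)) = 2 ^ n * m.descFactorial n := by
  induction n with
  | zero => simp
  | succ n ih =>
    rw [Finset.prod_Icc_succ_top (by lia), ih, Nat.descFactorial_succ]
    rcases le_or_gt n m with hnm | hmn
    · push_cast [Nat.cast_sub hnm]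
      ring
    · simp [Nat.descFactorial_of_lt hmn]

open Classical in
theorem eval_arrangementCharPoly_coxeterB (p : Fin n → ℝ) (m : ℕ) :
    (arrangementCharPoly ((fun W => AffineSubspace.mk' p W) '' coxeterB n)).eval (2 * m + 1 : ℤ) =
      2 ^ n * m.descFactorial n := by
  let shiftedCast : (Fin n → ℤ) ↪ (Fin n → ℝ) :=
    ⟨fun z => Int.cast ∘ z + p, (add_left_injective p).comp Int.cast_injective.comp_left⟩
  have hmem (z) (W : Submodule ℝ (Fin n → ℝ)) :
      shiftedCast z ∈ AffineSubspace.mk' p W ↔ Int.cast ∘ z ∈ W := by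
    rw [AffineSubspace.mem_mk']
    simp [shiftedCast]
  have htop : ⊤ ∉ (fun W => AffineSubspace.mk' p W) '' coxeterB n := by
    rintro ⟨W, hW, hWtop⟩
    have hdir := congrArg AffineSubspace.direction hWtop
    rw [AffineSubspace.direction_mk', AffineSubspace.direction_top] at hdir
    exact top_notMem_coxeterB (hdir ▸ hW)
  rw [eval_arrangementCharPoly (finite_coxeterB.image _) htop
    (Z := (intBox (Fin n) m).map shiftedCast)]
  · have havoid (z) : (∀ H ∈ (fun W => AffineSubspace.mk' p W) '' coxeterB n, shiftedCast z ∉ H) ↔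
        (∀ i, z i ≠ 0) ∧ Function.Injective fun i => |z i| := by
      simp only [Set.forall_mem_image, hmem, ← forall_coxeterB_intCast_notMem_iff]
    have hcard := card_filter_injective_abs_intBox (ι := Fin n) m
    rw [Fintype.card_fin] at hcard
    simp only [Finset.filter_map, Finset.card_map, Function.comp_apply, havoid]
    convert congrArg (Nat.cast : ℕ → ℤ) hcard
    push_cast
    rfl
  · rintro Y ⟨-, B, hB, rfl⟩
    obtain ⟨V, J, hV, hBV⟩ := exists_isSignedBasis_sInf hB
    rw [hBV, AffineSubspace.direction_mk', hV.finrank_eq, Finset.filter_map, Finset.card_map]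
    simp only [Function.comp_apply, hmem]
    exact_mod_cast hV.card_filter_intBox m

theorem arrangementCharPoly_coxeterB (p : Fin n → ℝ) :
    arrangementCharPoly ((fun W => AffineSubspace.mk' p W) '' coxeterB n) =
      ∏ k ∈ Finset.Icc 1 n, (X - C (2 * (k : ℤ) - 1)) := by
  refine Polynomial.eq_of_infinite_eval_eq _ _ <|
    Set.infinite_of_injective_forall_mem (f := fun m : ℕ => (2 * m + 1 : ℤ))
      (fun a b hab => by lia) fun m => ?_
  rw [Set.mem_ofPred_eq, eval_arrangementCharPoly_coxeterB, eval_prod,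
    ← prod_sub_odd_eq_descFactorial]
  simp only [eval_sub, eval_X, eval_C]

end CoxeterB

end CoxeterArrangement

theorem mainTheorem5 :
    -- (a)
    (∀ n : ℕ, 1 ≤ n →
      validOrderArrangement (visArrangement (stdCube n)) (cubeCenter n) =
          (fun W => AffineSubspace.mk' (cubeCenter n) W) '' coxeterB n ∧
      arrangementCharPoly (validOrderArrangement (visArrangement (stdCube n)) (cubeCenter n)) =
          ∏ k ∈ Finset.Icc 1 n, (X - C (2 * (k : ℤ) - 1)) ∧
      (lineShellingsThrough (stdCube n) (cubeCenter n)).ncard = 2 ^ n * n !) ∧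
    -- (b)
    (∀ n : ℕ, 1 ≤ n → (lineShellings (stdCube n)).ncard = 2 ^ n * (n !) ^ 2) ∧
    -- (c)
    (PowerSeries.mk (fun n : ℕ => if n = 0 then (0 : ℚ) else (numCubeShellings n : ℚ) / (n ! : ℚ)) =
      1 - (PowerSeries.mk (fun n : ℕ => ((2 * n)! : ℚ) / (n ! : ℚ)))⁻¹) ∧
    -- (d)
    (∀ n : ℕ, 1 ≤ n → ∀ L ∈ shellings (stdCube n),
      ∃ Q : Set (Fin n → ℝ), IsPolytope Q ∧
        ∃ e : Face (stdCube n) ≃o Face Q, ∃ L' ∈ lineShellings Q, Corresponds e L L') := by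
  refine ⟨fun n _ => ⟨validOrderArrangement_stdCube n, ?_, ?_⟩, fun n _ => ?_,
    mk_numCubeShellings, fun n hn L hL => ?_⟩
  · rw [validOrderArrangement_stdCube, arrangementCharPoly_coxeterB]
  · have hcard := ncard_lineShellingsThrough_stdCubeSystem_center (ι := Fin n)
    rwa [stdCubeSystem_face_empty, Fintype.card_fin] at hcard
  · have hcard := ncard_lineShellings_stdCubeSystem (ι := Fin n)
    rwa [stdCubeSystem_face_empty, Fintype.card_fin] at hcard
  · have : NeZero n := ⟨by lia⟩
    rw [← stdCubeSystem_face_empty] at hL ⊢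
    exact (stdCubeSystem (Fin n)).exists_realization hL
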